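/- Consider first-order rational Pavelka logic $\mathbf{RPL}\forall$, with truth values in $[0,1]$ ($0$ is the truest value, $1$ the falsest), primitive connectives $\to$ (interpreted by $(x,y)\mapsto\max(y-x,0)$), $\forall$ (interpreted by the supremum), a truth constant $\bar r$ for each $r\in\mathbb{Q}\cap[0,1]$, $\bot=\bar 1$, $\neg\varphi=\varphi\to\bot$, $\varphi\vee\psi=(\varphi\to\psi)\to\psi$, and with its usual Hilbert-style provability relation $\vdash$ (the axioms and rules of first-order Łukasiewicz logic together with the bookkeeping axioms $(\bar r\to\bar s)\leftrightarrow\overline{\max(s-r,0)}$). A theory $T$ is a set of formulas in a language; it is *computably axiomatizable* if its language is computably given and its set of axioms is computably enumerable, *consistent* if $T\nvdash\bot$, and *linear-complete* if for all sentences $\varphi,\psi$ of its language $T\vdash\varphi\to\psi$ or $T\vdash\psi\to\varphi$. A theory $T'$ *extends* $T$ if the language of $T'$ contains that of $T$ and $T'$ proves every axiom of $T$. A *decidable model* of $T$ is a standard ($[0,1]$-valued) structure on a complete metric space (a countable structure being given the discrete metric), with continuous operations and relations, in which for some evaluation all axioms of $T$ have truth degree $0$, and which has a countable dense set of elements, enumerated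 as $(e_n)_{n\in\mathbb N}$, such that the set of all pairs of a formula with parameters among the $e_n$ (named by their indices) and a rational interval $[p,q]\subseteq[0,1]$ whose interior relative to $[0,1]$ contains the truth degree of that formula is computably enumerable. **Corollary 3.11.** There is a computably axiomatizable, consistent theory $T$ in $\mathbf{RPL}\forall$ that has no decidable model and that moreover has no computably axiomatizable, consistent, linear-complete extension. The theory $T$ can be taken to be a classical theory of Łukasiewicz logic: its axioms contain no truth constant other than $\bot$, and $T\vdash\varphi\vee\neg\varphi$ for every formula $\varphi$ of its language that contains no truth constant other than $\bot$. -/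

import Mathlib

universe u

namespace RPL

/-! ### Syntax

Symbols are pairs (arity, index). A language is a set of function symbols together with a set of
relation symbols; constants are function symbols of arity 0, and the variables are indexed by the
natural numbers. There is no logical equality: a similarity relation, if wanted, is a binary relation
symbol of the language. -/

/-- A first-order language: which pairs (arity, index) are its function and relation symbols. -/
structure Lang where
  funs : Set (ℕ × ℕ)
  rels : Set (ℕ × ℕ)

/-- `L` is computably given: its sets of function and of relation symbols are decidable
(the arity of a symbol is its first coordinate). -/
def Lang.ComputablyGiven (L : Lang) : Prop :=
  ComputablePred (fun p : ℕ × ℕ => p ∈ L.funs) ∧ ComputablePred (fun p : ℕ × ℕ => p ∈ L.rels)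

/-- The rationals in `[0, 1]`. -/
abbrev UnitRat : Type := {r : ℚ // 0 ≤ r ∧ r ≤ 1}

/-- Truncated subtraction `s ∸ r = max (s - r) 0` on the rationals in `[0, 1]`. -/
def UnitRat.tsub (s r : UnitRat) : UnitRat :=
  ⟨max (s.1 - r.1) 0, le_max_right _ _,
    max_le (by linarith [s.2.2, r.2.1]) zero_le_one⟩

inductive Term : Type
  | var (x : ℕ) : Term
  | app (k i : ℕ) (ts : Fin k → Term) : Term

/-- Formulas of rational Pavelka logic. The truth constants are the rationals in `[0, 1]`,
where 0 is the truest and 1 the falsest value. -/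
inductive Formula : Type
  | const (r : UnitRat) : Formula
  | rel (k i : ℕ) (ts : Fin k → Term) : Formula
  | imp (φ ψ : Formula) : Formula
  | all (x : ℕ) (φ : Formula) : Formula

namespace Term

/-- All function symbols of the term belong to `L`. -/
def InLang (L : Lang) : Term → Prop
  | var _ => True
  | app k i ts => (k, i) ∈ L.funs ∧ ∀ j, (ts j).InLang L

/-- The variable `x` occurs in the term. -/
def Occurs (x : ℕ) : Term → Prop
  | var y => x = y
  | app _ _ ts => ∃ j, (ts j).Occurs x

/-- Replace the variable `x` by the term `t`. -/
def subst (x : ℕ) (t : Term) : Term → Term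
  | var y => if y = x then t else var y
  | app k i ts => app k i (fun j => Term.subst x t (ts j))

/-- Gödel number. -/
def code : Term → ℕ
  | var x => Nat.pair 0 x
  | app k i ts =>
      Nat.pair 1 (Nat.pair k (Nat.pair i (Encodable.encode (List.ofFn fun j => (ts j).code))))

end Term

/-- Gödel number of a rational in `[0, 1]`. -/
def UnitRat.code (r : UnitRat) : ℕ := Nat.pair r.1.num.toNat r.1.den

namespace Formula

/-- Falsity, the truth constant of value 1. -/
def bot : Formula := const ⟨1, zero_le_one, le_rfl⟩

def neg (φ : Formula) : Formula := imp φ bot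

/-- Strong conjunction, interpreted by `min (x + y) 1`. -/
def oplus (φ ψ : Formula) : Formula := neg (imp φ (neg ψ))

/-- Disjunction, interpreted by `min x y`. -/
def or (φ ψ : Formula) : Formula := imp (imp φ ψ) ψ

def iff (φ ψ : Formula) : Formula := oplus (imp φ ψ) (imp ψ φ)

/-- All symbols of the formula belong to `L`. -/
def InLang (L : Lang) : Formula → Prop
  | const _ => True
  | rel k i ts => (k, i) ∈ L.rels ∧ ∀ j, (ts j).InLang L
  | imp φ ψ => φ.InLang L ∧ ψ.InLang L
  | all _ φ => φ.InLang L

/-- The variable `x` occurs free in the formula. -/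
def Free (x : ℕ) : Formula → Prop
  | const _ => False
  | rel _ _ ts => ∃ j, (ts j).Occurs x
  | imp φ ψ => φ.Free x ∨ ψ.Free x
  | all y φ => x ≠ y ∧ φ.Free x

def IsSentence (φ : Formula) : Prop := ∀ x, ¬ φ.Free x

/-- Replace the free occurrences of the variable `x` by the term `t`. -/
def subst (x : ℕ) (t : Term) : Formula → Formula
  | const r => const r
  | rel k i ts => rel k i (fun j => Term.subst x t (ts j))
  | imp φ ψ => imp (φ.subst x t) (ψ.subst x t)
  | all y φ => if y = x then all y φ else all y (φ.subst x t)

/-- No variable of `t` becomes bound when `t` is substituted for `x`. -/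
def FreeFor (x : ℕ) (t : Term) : Formula → Prop
  | const _ => True
  | rel _ _ _ => True
  | imp φ ψ => φ.FreeFor x t ∧ ψ.FreeFor x t
  | all y φ => ¬ (all y φ).Free x ∨ (¬ t.Occurs y ∧ φ.FreeFor x t)

/-- Formulas of plain first-order Łukasiewicz logic: no truth constant other than falsity. -/
def IsLukasiewicz : Formula → Prop
  | const r => r.1 = 1
  | rel _ _ _ => True
  | imp φ ψ => φ.IsLukasiewicz ∧ ψ.IsLukasiewicz
  | all _ φ => φ.IsLukasiewicz

/-- Gödel number. -/
def code : Formula → ℕ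
  | const r => Nat.pair 0 r.code
  | rel k i ts =>
      Nat.pair 1 (Nat.pair k (Nat.pair i (Encodable.encode (List.ofFn fun j => (ts j).code))))
  | imp φ ψ => Nat.pair 2 (Nat.pair φ.code ψ.code)
  | all x φ => Nat.pair 3 (Nat.pair x φ.code)

end Formula

/-! ### Provability -/

open Formula in
/-- `Provable L T φ`: there is a proof of `φ` from the axioms `T` in rational Pavelka logic over
the language `L`; all formulas and terms that occur in the proof belong to `L`. -/
inductive Provable (L : Lang) (T : Set Formula) : Formula → Prop
  | hyp {φ} : φ ∈ T → φ.InLang L → Provable L T φ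
  | ax1 {φ ψ} : φ.InLang L → ψ.InLang L → Provable L T (imp φ (imp ψ φ))
  | ax2 {φ ψ σ} : φ.InLang L → ψ.InLang L → σ.InLang L →
      Provable L T (imp (imp φ ψ) (imp (imp ψ σ) (imp φ σ)))
  | ax3 {φ ψ} : φ.InLang L → ψ.InLang L →
      Provable L T (imp (imp (imp φ ψ) ψ) (imp (imp ψ φ) φ))
  | ax4 {φ ψ} : φ.InLang L → ψ.InLang L →
      Provable L T (imp (imp (imp φ bot) (imp ψ bot)) (imp ψ φ))
  | all1 {φ x t} : φ.InLang L → t.InLang L → φ.FreeFor x t →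
      Provable L T (imp (all x φ) (φ.subst x t))
  | all2 {φ ψ x} : φ.InLang L → ψ.InLang L → ¬ φ.Free x →
      Provable L T (imp (all x (imp φ ψ)) (imp φ (all x ψ)))
  | axR (r s : UnitRat) :
      Provable L T (iff (imp (const r) (const s)) (const (UnitRat.tsub s r)))
  | mp {φ ψ} : Provable L T φ → Provable L T (imp φ ψ) → Provable L T ψ
  | gen {φ} (x : ℕ) : Provable L T φ → Provable L T (all x φ)

/-! ### Theories -/

/-- A theory: a language and a set of formulas of that language. -/
structure Theory where
  lang : Lang
  axioms : Set Formula
  inLang : ∀ φ ∈ axioms, φ.InLang lang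

namespace Theory

def Proves (T : Theory) (φ : Formula) : Prop := Provable T.lang T.axioms φ

def Consistent (T : Theory) : Prop := ¬ T.Proves Formula.bot

/-- The language is computably given and the set of axioms is computably enumerable. -/
def ComputablyAxiomatizable (T : Theory) : Prop :=
  T.lang.ComputablyGiven ∧ REPred (fun n : ℕ => ∃ φ ∈ T.axioms, φ.code = n)

/-- Any two sentences of the language are comparable. -/
def LinearComplete (T : Theory) : Prop :=
  ∀ φ ψ : Formula, φ.InLang T.lang → ψ.InLang T.lang → φ.IsSentence → ψ.IsSentence →
    T.Proves (Formula.imp φ ψ) ∨ T.Proves (Formula.imp ψ φ)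

/-- `T'` extends `T`: its language contains that of `T`, and it proves the axioms of `T`. -/
def Extends (T' T : Theory) : Prop :=
  T.lang.funs ⊆ T'.lang.funs ∧ T.lang.rels ⊆ T'.lang.rels ∧ ∀ φ ∈ T.axioms, T'.Proves φ

/-- A theory of plain Łukasiewicz logic: its axioms use no truth constant other than falsity. -/
def IsLukasiewicz (T : Theory) : Prop := ∀ φ ∈ T.axioms, φ.IsLukasiewicz

/-- A classical theory: it proves excluded middle for every formula of its language in which
no truth constant other than falsity occurs. -/
def Classical (T : Theory) : Prop :=
  ∀ φ : Formula, φ.InLang T.lang → φ.IsLukasiewicz → T.Proves (Formula.or φ (Formula.neg φ))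

end Theory

/-! ### Standard structures -/

/-- A standard structure on `M`: relations take values in the real unit interval. All symbols are
interpreted; the ones outside the language under consideration play no role. -/
structure Interp (M : Type u) where
  fn : (k i : ℕ) → (Fin k → M) → M
  rel : (k i : ℕ) → (Fin k → M) → unitInterval

def Term.eval {M : Type u} (S : Interp M) (v : ℕ → M) : Term → M
  | .var x => v x
  | .app k i ts => S.fn k i (fun j => (ts j).eval S v)

/-- The truth degree of a formula under the evaluation `v` (0 is true, 1 is false). The supremum
is taken over a family of reals in `[0, 1]`. -/
noncomputable def Formula.eval {M : Type u} (S : Interp M) : Formula → (ℕ → M) → ℝ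
  | .const r, _ => (r.1 : ℝ)
  | .rel k i ts, v => (S.rel k i (fun j => (ts j).eval S v) : ℝ)
  | .imp φ ψ, v => max (ψ.eval S v - φ.eval S v) 0
  | .all x φ, v => ⨆ a : M, φ.eval S (Function.update v x a)

/-- The pair of the structure and the evaluation is a model of `T`. -/
def Interp.Models {M : Type u} (S : Interp M) (v : ℕ → M) (T : Theory) : Prop :=
  ∀ φ ∈ T.axioms, φ.eval S v = 0

/-- The interval `[p, q]` approximates the maximal element `{a}` of the domain of closed
subintervals of `[0, 1]`: the number `a` lies in the interior of `[p, q]` relative to `[0, 1]`. -/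
def WayBelow (p q : UnitRat) (a : ℝ) : Prop :=
  (((p.1 : ℚ) : ℝ) < a ∨ p.1 = 0) ∧ (a < ((q.1 : ℚ) : ℝ) ∨ q.1 = 1)

/-- The elementary diagram of the structure over the elements enumerated by `e`. A formula of `L`
with parameters is a formula `φ` of `L` with a list `s` of numbers: the variable `x` takes the value
`e n`, where `n` is the entry of `s` at position `x` (0 beyond the end of the list). The diagram
lists the rational intervals that approximate its truth degree. -/
def Interp.Diagram {M : Type u} (S : Interp M) (L : Lang) (e : ℕ → M) :
    ℕ × List ℕ × ℕ × ℕ → Prop :=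
  fun z => ∃ (φ : Formula) (p q : UnitRat), φ.InLang L ∧
    z.1 = φ.code ∧ z.2.2.1 = p.code ∧ z.2.2.2 = q.code ∧
    WayBelow p q (φ.eval S (fun x => e (z.2.1.getD x 0)))

/-- `S` is decidable as a structure for `L`, on a complete metric space (a countable structure being
one with the discrete metric): the operations and relations of `L` are continuous, and for some
enumeration of a dense set the elementary diagram over it is computably enumerable. -/
def Interp.IsDecidable {M : Type u} [MetricSpace M] (S : Interp M) (L : Lang) : Prop :=
  CompleteSpace M ∧
  (∀ k i, (k, i) ∈ L.funs → Continuous (S.fn k i)) ∧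
  (∀ k i, (k, i) ∈ L.rels → Continuous (S.rel k i)) ∧
  ∃ e : ℕ → M, DenseRange e ∧ REPred (S.Diagram L e)

def Theory.HasDecidableModel (T : Theory) : Prop :=
  ∃ (M : Type u) (_ : MetricSpace M) (S : Interp M) (v : ℕ → M),
    S.IsDecidable T.lang ∧ S.Models v T

end RPL

/-!
The sets `A` and `B` of the numbers of programs that output `0` and `1` on their own number are
recursively enumerable and cannot be separated by a decidable set. The classical theory that asserts
an atomic sentence `aₙ` for `n ∈ A` and its negation for `n ∈ B` is consistent, as it has a
two-valued model. From a decidable model or a linear-complete extension one could extract two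
recursively enumerable sets that cover the natural numbers, one disjoint from `B` and the other
from `A`, and hence a separation: in a decidable model, the sets of the `n` for which the truth
degree of `aₙ` is below `2 / 3` or above `1 / 3`; in a linear-complete extension, those for which
`¬ aₙ → aₙ` or `aₙ → ¬ aₙ` is provable.
-/

namespace RPL

open Encodable

section RecursivelyEnumerable

variable {α β : Type*} [Primcodable α] [Primcodable β]

theorem rePred_comp {p : β → Prop} {f : α → β} (hp : REPred p) (hf : Computable f) :
    REPred fun a => p (f a) :=
  Partrec.comp hp hf

theorem rePred_and {p q : α → Prop} (hp : REPred p) (hq : REPred q) :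
    REPred fun a => p a ∧ q a := by
  have both : Partrec fun a => (Part.assert (p a) fun _ => Part.some ()).bind fun _ =>
      Part.assert (q a) fun _ => Part.some () :=
    Partrec.bind hp (Partrec.comp hq Computable.fst).to₂
  exact both.dom_re.of_eq fun a => by simp [Part.dom_iff_mem]

theorem rePred_or {p q : α → Prop} (hp : REPred p) (hq : REPred q) :
    REPred fun a => p a ∨ q a := by
  obtain ⟨k, hk, hkdom⟩ := Partrec.merge' hp hq
  exact hk.dom_re.of_eq fun a => by simp [(hkdom a).2, Part.assert]

theorem rePred_exists_nat {q : α × ℕ → Prop} (hq : ComputablePred q) :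
    REPred fun a => ∃ n, q (a, n) := by
  obtain ⟨_, hq⟩ := hq
  have search : Partrec fun a => Nat.rfind fun n => Part.some (decide (q (a, n))) :=
    Partrec.rfind hq.to₂.partrec₂
  exact search.dom_re.of_eq fun a => Nat.rfind_dom.trans
    ⟨fun ⟨n, hn, _⟩ => ⟨n, by simpa using hn⟩,
      fun ⟨n, hn⟩ => ⟨n, by simpa using hn, fun _ => trivial⟩⟩

theorem exists_primrec_enumeration {p : α → Prop} (hp : REPred p) :
    ∃ g : ℕ → Option α, Primrec g ∧ ∀ a, p a ↔ ∃ n, g n = some a := by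
  obtain ⟨c, hc⟩ := Nat.Partrec.Code.exists_code.1 hp
  have halts_iff (a : α) : p a ↔ ∃ s, (c.evaln s (encode a)).isSome := by
    have : p a ↔ (c.eval (encode a)).Dom := by rw [hc]; simp [Part.assert]
    simp only [this, Part.dom_iff_mem, Nat.Partrec.Code.evaln_complete, Option.isSome_iff_exists,
      Option.mem_def]
    exact exists_comm
  refine ⟨fun n => (decode (α := ℕ × α) n).bind fun z =>
    (c.evaln z.1 (encode z.2)).map fun _ => z.2, ?_, fun a => ?_⟩
  · have bounded : Primrec fun z : ℕ × α => c.evaln z.1 (encode z.2) :=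
      Nat.Partrec.Code.primrec_evaln.comp ((Primrec.fst.pair (Primrec.const c)).pair
        (Primrec.encode.comp Primrec.snd))
    exact Primrec.option_bind Primrec.decode
      ((Primrec.option_map bounded (Primrec.snd.comp Primrec.fst).to₂).comp Primrec.snd).to₂
  · rw [halts_iff]
    constructor
    · rintro ⟨s, hs⟩
      obtain ⟨y, hy⟩ := Option.isSome_iff_exists.1 hs
      exact ⟨encode (s, a), by simp [encodek, hy]⟩
    · rintro ⟨n, hn⟩
      obtain ⟨⟨s, b⟩, -, h⟩ := Option.bind_eq_some_iff.1 hn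
      obtain ⟨y, hy, rfl⟩ := Option.map_eq_some_iff.1 h
      exact ⟨s, Option.isSome_iff_exists.2 ⟨y, hy⟩⟩

theorem rePred_of_primrec_enumeration {g : ℕ → Option α} (hg : Primrec g) :
    REPred fun a => ∃ n, g n = some a :=
  rePred_exists_nat (q := fun z => g z.2 = some z.1) <| PrimrecPred.computablePred <|
    Primrec.eq.comp (hg.comp Primrec.snd) (Primrec.option_some.comp Primrec.fst)

theorem rePred_exists {p : α × β → Prop} (hp : REPred p) : REPred fun a => ∃ b, p (a, b) := by
  obtain ⟨g, hg, hpg⟩ := exists_primrec_enumeration hp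
  have enumeration : Primrec fun n => (g n).map Prod.fst :=
    Primrec.option_map hg (Primrec.fst.comp Primrec.snd).to₂
  refine (rePred_of_primrec_enumeration enumeration).of_eq fun a => ?_
  simp only [hpg, Option.map_eq_some_iff, Prod.exists, exists_and_right, exists_eq_right]
  exact exists_comm

theorem rePred_image {p : α → Prop} {f : α → β} (hp : REPred p) (hf : Primrec f) :
    REPred fun b => ∃ a, p a ∧ f a = b :=
  rePred_exists (p := fun z : β × α => p z.2 ∧ f z.2 = z.1) <|
    rePred_and (rePred_comp hp Computable.snd) <| ComputablePred.to_re <|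
      PrimrecPred.computablePred <| Primrec.eq.comp (hf.comp Primrec.snd) Primrec.fst

theorem primrecRel_mem_list : PrimrecRel fun (a : α) (l : List α) => a ∈ l :=
  (Primrec.eq.exists_mem_list.comp Primrec.snd Primrec.fst).of_eq fun z => by simp

theorem rePred_forall_mem_list {p : α → Prop} (hp : REPred p) :
    REPred fun l : List α => ∀ a ∈ l, p a := by
  obtain ⟨g, hg, hpg⟩ := exists_primrec_enumeration hp
  have indices_iff (l : List α) : (∃ ns : List ℕ, ns.map g = l.map some) ↔ ∀ a ∈ l, p a := by
    induction l with
    | nil => simp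
    | cons a l ih =>
      simp only [List.map_cons, List.map_eq_cons_iff, List.forall_mem_cons, hpg]
      grind
  refine (rePred_exists (p := fun z : List α × List ℕ => z.2.map g = z.1.map some) <|
    ComputablePred.to_re <| PrimrecPred.computablePred <| Primrec.eq.comp ?_ ?_).of_eq indices_iff
  · exact Primrec.list_map Primrec.snd (hg.comp Primrec.snd).to₂
  · exact Primrec.list_map Primrec.fst (Primrec.option_some.comp Primrec.snd).to₂

end RecursivelyEnumerable

/-- The smallest set closed under the rules `R`, which relate lists of premises to conclusions. -/
inductive Derivable {α : Type*} (R : List α → α → Prop) : α → Prop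
  | intro {ps : List α} {a : α} : R ps a → (∀ b ∈ ps, Derivable R b) → Derivable R a

namespace Derivable

variable {α : Type*} {g : ℕ → Option (List α × α)}

open Classical in
/-- The conclusions drawn after `n` attempts to apply a rule from the enumeration `g`. The rule
tried at step `n` is number `n.unpair.1`, so that every rule is tried infinitely often. -/
noncomputable def stage (g : ℕ → Option (List α × α)) : ℕ → List α
  | 0 => []
  | n + 1 => (g n.unpair.1).elim (stage g n) fun r =>
      if ∀ b ∈ r.1, b ∈ stage g n then r.2 :: stage g n else stage g n

theorem mem_stage_succ {n : ℕ} {a : α} : a ∈ stage g (n + 1) ↔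
    a ∈ stage g n ∨ ∃ ps, g n.unpair.1 = some (ps, a) ∧ ∀ b ∈ ps, b ∈ stage g n := by
  rw [stage]
  rcases g n.unpair.1 with _ | ⟨ps, c⟩
  · simp
  · simp only [Option.elim_some]
    split_ifs with h
    · simp only [List.mem_cons, Option.some.injEq, Prod.mk.injEq]
      grind
    · simp only [Option.some.injEq, Prod.mk.injEq]
      grind

theorem monotone_mem_stage (a : α) : Monotone fun n => a ∈ stage g n :=
  monotone_nat_of_le_succ fun _ h => mem_stage_succ.2 (.inl h)

theorem iff_exists_mem_stage {R : List α → α → Prop}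
    (hg : ∀ ps a, R ps a ↔ ∃ n, g n = some (ps, a)) (a : α) :
    Derivable R a ↔ ∃ n, a ∈ stage g n := by
  constructor
  · intro h
    induction h with
    | @intro ps a hrule _ ih =>
      obtain ⟨i, hi⟩ := (hg ps a).1 hrule
      choose! s hs using ih
      let N := (ps.map s).sum
      have premises : ∀ b ∈ ps, b ∈ stage g (Nat.pair i N) := fun b hb =>
        monotone_mem_stage b
          ((List.single_le_sum (by simp) _ (List.mem_map_of_mem hb)).trans (Nat.right_le_pair i N))
          (hs b hb)
      exact ⟨Nat.pair i N + 1, mem_stage_succ.2 (.inr ⟨ps, by simpa using hi, premises⟩)⟩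
  · rintro ⟨n, hn⟩
    induction n generalizing a with
    | zero => simp [stage] at hn
    | succ n ih =>
      rcases mem_stage_succ.1 hn with hn | ⟨ps, hrule, premises⟩
      · exact ih a hn
      · exact .intro ((hg ps a).2 ⟨_, hrule⟩) fun b hb => ih b (premises b hb)

theorem primrec_stage [Primcodable α] (hg : Primrec g) : Primrec (stage g) := by
  classical
  have hall : PrimrecRel fun ps l : List α => ∀ b ∈ ps, b ∈ l := primrecRel_mem_list.forall_mem_list
  have attempt : Primrec fun z : (ℕ × List α) × List α × α =>
      if ∀ b ∈ z.2.1, b ∈ z.1.2 then z.2.2 :: z.1.2 else z.1.2 := by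
    refine Primrec.ite (hall.comp ?_ ?_) (Primrec.list_cons.comp ?_ ?_) ?_
    exacts [Primrec.fst.comp Primrec.snd, Primrec.snd.comp Primrec.fst,
      Primrec.snd.comp Primrec.snd, Primrec.snd.comp Primrec.fst, Primrec.snd.comp Primrec.fst]
  refine (Primrec.nat_rec₁ (f := fun n l => ((g n.unpair.1).elim l fun r =>
    if ∀ b ∈ r.1, b ∈ l then r.2 :: l else l : List α)) [] ?_).of_eq fun n => ?_
  · exact (Primrec.option_casesOn (hg.comp (Primrec.fst.comp (Primrec.unpair.comp Primrec.fst)))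
      Primrec.snd attempt.to₂).to₂.of_eq fun n l => by cases g n.unpair.1 <;> rfl
  · induction n with
    | zero => rfl
    | succ n ih => simp only [stage, ← ih]

theorem rePred [Primcodable α] {R : List α → α → Prop}
    (hR : REPred fun r : List α × α => R r.1 r.2) : REPred (Derivable R) := by
  obtain ⟨g, hg, hRg⟩ := exists_primrec_enumeration hR
  exact (rePred_exists_nat (q := fun z => z.1 ∈ stage g z.2) <| PrimrecPred.computablePred <|
    primrecRel_mem_list.comp Primrec.fst ((primrec_stage hg).comp Primrec.snd)).of_eq fun a =>
      (iff_exists_mem_stage (fun ps a => hRg (ps, a)) a).symm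

end Derivable

attribute [fun_prop] Primrec

section

variable {α β γ δ : Type*} [Primcodable α] [Primcodable β] [Primcodable γ] [Primcodable δ]

@[fun_prop] theorem primrec_id : Primrec fun a : α => a := Primrec.id

@[fun_prop] theorem primrec_const (b : β) : Primrec fun _ : α => b := Primrec.const b

@[fun_prop] theorem primrec_comp {f : β → γ} {g : α → β} (hf : Primrec f) (hg : Primrec g) :
    Primrec fun a => f (g a) := hf.comp hg

@[fun_prop] theorem primrec_mk {f : α → β} {g : α → γ} (hf : Primrec f) (hg : Primrec g) :
    Primrec fun a => (f a, g a) := hf.pair hg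

@[fun_prop] theorem primrec_fst {f : α → β × γ} (hf : Primrec f) : Primrec fun a => (f a).1 :=
  Primrec.fst.comp hf

@[fun_prop] theorem primrec_snd {f : α → β × γ} (hf : Primrec f) : Primrec fun a => (f a).2 :=
  Primrec.snd.comp hf

@[fun_prop] theorem primrec_some {f : α → β} (hf : Primrec f) : Primrec fun a => some (f a) :=
  Primrec.option_some.comp hf

@[fun_prop] theorem primrec_inl {f : α → β} (hf : Primrec f) :
    Primrec fun a => (Sum.inl (f a) : β ⊕ γ) := Primrec.sumInl.comp hf

@[fun_prop] theorem primrec_inr {f : α → γ} (hf : Primrec f) :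
    Primrec fun a => (Sum.inr (f a) : β ⊕ γ) := Primrec.sumInr.comp hf

@[fun_prop] theorem primrec_option_map {f : α → Option β} {g : α → β → γ} (hf : Primrec f)
    (hg : Primrec fun z : α × β => g z.1 z.2) : Primrec fun a => (f a).map (g a) :=
  Primrec.option_map hf hg

@[fun_prop] theorem primrec_option_bind {f : α → Option β} {g : α → β → Option γ} (hf : Primrec f)
    (hg : Primrec fun z : α × β => g z.1 z.2) : Primrec fun a => (f a).bind (g a) :=
  Primrec.option_bind hf hg

@[fun_prop] theorem primrec_sum_elim {f : α → β ⊕ γ} {g : α → β → δ} {h : α → γ → δ}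
    (hf : Primrec f) (hg : Primrec fun z : α × β => g z.1 z.2)
    (hh : Primrec fun z : α × γ => h z.1 z.2) : Primrec fun a => (f a).elim (g a) (h a) :=
  (Primrec.sumCasesOn hf hg hh).of_eq fun a => by cases f a <;> rfl

@[fun_prop] theorem primrec_encode {f : α → β} (hf : Primrec f) : Primrec fun a => encode (f a) :=
  Primrec.encode.comp hf

@[fun_prop] theorem primrec_decode {f : α → ℕ} (hf : Primrec f) :
    Primrec fun a => (decode (f a) : Option β) :=
  Primrec.decode.comp hf

@[fun_prop] theorem primrec_list_cons {f : α → β} {g : α → List β} (hf : Primrec f)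
    (hg : Primrec g) : Primrec fun a => f a :: g a := Primrec.list_cons.comp hf hg

@[fun_prop] theorem primrec_list_length {f : α → List β} (hf : Primrec f) :
    Primrec fun a => (f a).length := Primrec.list_length.comp hf

@[fun_prop] theorem primrec_list_getElem? {f : α → List β} {g : α → ℕ} (hf : Primrec f)
    (hg : Primrec g) : Primrec fun a => (f a)[g a]? := Primrec.list_getElem?.comp hf hg

@[fun_prop] theorem primrec_natPair {f g : α → ℕ} (hf : Primrec f) (hg : Primrec g) :
    Primrec fun a => Nat.pair (f a) (g a) := Primrec₂.natPair.comp hf hg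

@[fun_prop] theorem primrec_unpair {f : α → ℕ} (hf : Primrec f) :
    Primrec fun a => Nat.unpair (f a) := Primrec.unpair.comp hf

@[fun_prop] theorem primrec_add {f g : α → ℕ} (hf : Primrec f) (hg : Primrec g) :
    Primrec fun a => f a + g a := Primrec.nat_add.comp hf hg

@[fun_prop] theorem primrec_sub {f g : α → ℕ} (hf : Primrec f) (hg : Primrec g) :
    Primrec fun a => f a - g a := Primrec.nat_sub.comp hf hg

@[fun_prop] theorem primrec_mul {f g : α → ℕ} (hf : Primrec f) (hg : Primrec g) :
    Primrec fun a => f a * g a := Primrec.nat_mul.comp hf hg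

@[fun_prop] theorem primrec_mod {f g : α → ℕ} (hf : Primrec f) (hg : Primrec g) :
    Primrec fun a => f a % g a := Primrec.nat_mod.comp hf hg

theorem primrecPred_eq {f g : α → β} (hf : Primrec f) (hg : Primrec g) :
    PrimrecPred fun a => f a = g a := Primrec.eq.comp hf hg

end

/-- The numbering of a type by an injective function with primitive recursive range. -/
noncomputable abbrev primcodableOfInjective {α : Type*} {c : α → ℕ} (hc : Function.Injective c)
    (hrange : PrimrecPred (· ∈ Set.range c)) : Primcodable α where
  encode := c
  decode := Function.partialInv c
  encodek a := Function.partialInv_left hc a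
  prim := by
    classical
    have membership : Primrec fun n => if n ∈ Set.range c then n.succ else 0 :=
      Primrec.ite hrange Primrec.succ (Primrec.const 0)
    refine (Primrec.nat_iff.1 membership).of_eq fun n => ?_
    split_ifs with h
    · obtain ⟨a, rfl⟩ := h
      rw [Function.partialInv_left hc a]
      rfl
    · rw [Function.partialInv, dif_neg (by exact h)]
      rfl

theorem primrecPred_of_hereditary {p q : ℕ → Prop} {l : ℕ → List ℕ} (hq : PrimrecPred q)
    (hl : Primrec l) (hlt : ∀ n, ∀ m ∈ l n, m < n) (hp : ∀ n, p n ↔ q n ∧ ∀ m ∈ l n, p m) :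
    PrimrecPred p := by
  classical
  obtain ⟨_, hq⟩ := hq
  have hall : PrimrecPred fun bs : List Bool => ∀ b ∈ bs, b = true :=
    PrimrecPred.forall_mem_list (primrecPred_eq Primrec.id (Primrec.const true))
  obtain ⟨_, hall⟩ := hall
  refine ⟨inferInstance, Primrec.nat_omega_rec' (m := id) (l := l)
    (g := fun n bs => some (decide (q n) && decide (∀ b ∈ bs, b = true))) _
    Primrec.id hl ?_ hlt fun n => ?_⟩
  · exact (Primrec.option_some.comp (Primrec.and.comp (hq.comp Primrec.fst)
      (hall.comp Primrec.snd))).to₂.of_eq fun n bs => by congr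
  · simp [hp n]

namespace UnitRat

theorem code_injective : Function.Injective code := by
  intro r s h
  simp only [code, Nat.pair_eq_pair] at h
  have hr := Rat.num_nonneg.2 r.2.1
  have hs := Rat.num_nonneg.2 s.2.1
  exact Subtype.ext (Rat.ext (by omega) h.2)

theorem code_unpair_snd_pos (r : UnitRat) : 0 < r.code.unpair.2 := by
  simp [code, Nat.pos_iff_ne_zero]

theorem coe_eq_div_code (r : UnitRat) : r.1 = (r.code.unpair.1 : ℚ) / r.code.unpair.2 := by
  have num_eq : ((r.1.num.toNat : ℤ) : ℚ) = r.1.num := by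
    rw [Int.toNat_of_nonneg (Rat.num_nonneg.2 r.2.1)]
  rw [code, Nat.unpair_pair, ← Int.cast_natCast, num_eq, Rat.num_div_den]

theorem mem_range_code_iff (n : ℕ) : n ∈ Set.range code ↔
    n.unpair.2 ≠ 0 ∧ n.unpair.1 ≤ n.unpair.2 ∧ Nat.Coprime n.unpair.1 n.unpair.2 := by
  constructor
  · rintro ⟨r, rfl⟩
    refine ⟨r.code_unpair_snd_pos.ne', ?_, ?_⟩
    · have le_one := r.2.2
      rw [coe_eq_div_code, div_le_one (by exact_mod_cast r.code_unpair_snd_pos)] at le_one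
      exact_mod_cast le_one
    · have reduced := r.1.reduced
      rw [← Int.toNat_of_nonneg (Rat.num_nonneg.2 r.2.1), Int.natAbs_natCast] at reduced
      simpa only [code, Nat.unpair_pair] using reduced
  · rintro ⟨den_ne_zero, num_le_den, coprime⟩
    let r : ℚ := ⟨n.unpair.1, n.unpair.2, den_ne_zero, by simpa using coprime⟩
    have r_eq : r = (n.unpair.1 : ℚ) / n.unpair.2 := by
      rw [← Rat.num_div_den r]
      simp [r]
    refine ⟨⟨r, ?_, ?_⟩, by simp [code, r]⟩
    · rw [r_eq]
      positivity
    · rw [r_eq]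
      exact div_le_one_of_le₀ (by exact_mod_cast num_le_den) (by positivity)

theorem eq_tsub_iff (q s r : UnitRat) : q = tsub s r ↔
    q.code.unpair.1 * (s.code.unpair.2 * r.code.unpair.2) =
      (s.code.unpair.1 * r.code.unpair.2 - r.code.unpair.1 * s.code.unpair.2) *
        q.code.unpair.2 := by
  have cast_tsub (a b : ℕ) : ((a - b : ℕ) : ℚ) = max ((a : ℚ) - b) 0 := by
    have : ((a - b : ℕ) : ℤ) = max ((a : ℤ) - b) 0 := by omega
    exact_mod_cast congrArg (Int.cast : ℤ → ℚ) this
  have hq := q.code_unpair_snd_pos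
  have hr := r.code_unpair_snd_pos
  have hs := s.code_unpair_snd_pos
  simp only [Subtype.ext_iff, tsub, coe_eq_div_code]
  generalize q.code.unpair = q, r.code.unpair = r, s.code.unpair = s at *
  have tsub_eq : max ((s.1 : ℚ) / s.2 - r.1 / r.2) 0 =
      ((s.1 * r.2 - r.1 * s.2 : ℕ) : ℚ) / (s.2 * r.2 : ℕ) := by
    rw [cast_tsub, div_sub_div _ _ (by positivity) (by positivity), mul_comm (s.2 : ℚ) r.1]
    push_cast
    rw [← max_div_div_right (by positivity), zero_div]
  rw [tsub_eq, div_eq_div_iff (by positivity) (by positivity)]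
  norm_cast

theorem primrecPred_mem_range_code : PrimrecPred (· ∈ Set.range code) := by
  have common_divisor : PrimrecPred fun n : ℕ =>
      ∃ d < n.unpair.2 + 1, d ≠ 1 ∧ n.unpair.1 % d = 0 ∧ n.unpair.2 % d = 0 := by
    have : PrimrecRel fun d n : ℕ => d ≠ 1 ∧ n.unpair.1 % d = 0 ∧ n.unpair.2 % d = 0 := by
      refine (primrecPred_eq ?_ ?_).not.and ((primrecPred_eq ?_ ?_).and (primrecPred_eq ?_ ?_)) <;>
        fun_prop
    exact this.exists_lt.comp (by fun_prop) Primrec.id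
  have den_ne_zero : PrimrecPred fun n : ℕ => n.unpair.2 ≠ 0 :=
    (primrecPred_eq (by fun_prop) (by fun_prop)).not
  have num_le_den : PrimrecPred fun n : ℕ => n.unpair.1 ≤ n.unpair.2 :=
    Primrec.nat_le.comp (by fun_prop) (by fun_prop)
  refine (den_ne_zero.and (num_le_den.and common_divisor.not)).of_eq fun n => ?_
  rw [mem_range_code_iff]
  refine and_congr_right fun hn => and_congr_right fun _ => ⟨fun h => ?_, ?_⟩
  · by_contra not_coprime
    exact h ⟨_, Nat.lt_succ_of_le (Nat.gcd_le_right _ (Nat.pos_of_ne_zero hn)), not_coprime,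
      Nat.mod_eq_zero_of_dvd (Nat.gcd_dvd_left _ _), Nat.mod_eq_zero_of_dvd (Nat.gcd_dvd_right _ _)⟩
  · rintro coprime ⟨d, -, hd, hnum, hden⟩
    exact hd (Nat.eq_one_of_dvd_coprimes coprime (Nat.dvd_of_mod_eq_zero hnum)
      (Nat.dvd_of_mod_eq_zero hden))

noncomputable instance : Primcodable UnitRat :=
  primcodableOfInjective code_injective primrecPred_mem_range_code

-- Takes precedence over the generic encoding of a subtype of `ℚ`.
noncomputable instance : Encodable UnitRat := Primcodable.toEncodable

theorem encode_eq_code (r : UnitRat) : Encodable.encode r = r.code := rfl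

end UnitRat

theorem encode_list_eq_encode_map {α : Type*} [Encodable α] (l : List α) :
    encode l = encode (l.map encode) := by
  induction l with
  | nil => rfl
  | cons a l ih => simp only [List.map_cons, encode_list_cons, ih, encode_nat]

theorem encode_lt_encode_list_of_mem {α : Type*} [Encodable α] {a : α} {l : List α} (h : a ∈ l) :
    encode a < encode l := by
  induction l with
  | nil => simp at h
  | cons b l ih =>
    rw [encode_list_cons]
    rcases List.mem_cons.1 h with rfl | h
    · exact Nat.lt_succ_of_le (Nat.left_le_pair _ _)
    · exact (ih h).trans (Nat.lt_succ_of_le (Nat.right_le_pair _ _))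

theorem unpair_snd_lt {n : ℕ} (h : n.unpair.1 ≠ 0) : n.unpair.2 < n := by
  have := Nat.add_le_pair n.unpair.1 n.unpair.2
  rw [Nat.pair_unpair] at this
  omega

namespace Term

theorem code_injective : Function.Injective code := by
  intro s
  induction s with
  | var x =>
    intro t h
    cases t with
    | var y => simpa [code] using h
    | app k i ts => simp [code] at h
  | app k i ss ih =>
    intro t h
    cases t with
    | var y => simp [code] at h
    | app l j ts =>
      simp only [code, Nat.pair_eq_pair, true_and] at h
      obtain ⟨rfl, rfl, h⟩ := h
      have codes_eq := List.ofFn_injective (Encodable.encode_injective h)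
      simp only [app.injEq, heq_eq_eq, true_and]
      exact funext fun m => ih m (congrFun codes_eq m)

/-- The term with outermost function symbol number `i`, whose arity is the number of arguments. -/
def ofList (i : ℕ) (ts : List Term) : Term := app ts.length i ts.get

theorem ofList_ofFn {k : ℕ} (i : ℕ) (ts : Fin k → Term) :
    ofList i (List.ofFn ts) = app k i ts := by
  apply code_injective
  simp [ofList, code]

theorem code_ofList (i : ℕ) (ts : List Term) : (ofList i ts).code =
    Nat.pair 1 (Nat.pair ts.length (Nat.pair i (encode (ts.map code)))) := by
  rw [ofList, code, ← List.ofFn_get (ts.map code)]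
  simp

/-- The codes of the arguments of the application coded by `n` (when `n` codes an application). -/
def argCodes (n : ℕ) : List ℕ := Denumerable.ofNat (List ℕ) n.unpair.2.unpair.2.unpair.2

theorem mem_range_code_iff (n : ℕ) : n ∈ Set.range code ↔
    n.unpair.1 = 0 ∨ n.unpair.1 = 1 ∧ (argCodes n).length = n.unpair.2.unpair.1 ∧
      ∀ m ∈ argCodes n, m ∈ Set.range code := by
  constructor
  · rintro ⟨_ | ⟨k, i, ts⟩, rfl⟩
    · simp [code]
    · simp [code, argCodes]
  · rintro (h | ⟨htag, hlen, hargs⟩)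
    · exact ⟨var n.unpair.2, by rw [code, ← h, Nat.pair_unpair]⟩
    · obtain ⟨ts, hts⟩ := (Set.range_list_map code).ge hargs
      refine ⟨ofList n.unpair.2.unpair.2.unpair.1 ts, ?_⟩
      rw [code_ofList, ← List.length_map code, hts, hlen, argCodes, Denumerable.encode_ofNat,
        Nat.pair_unpair, Nat.pair_unpair, ← htag, Nat.pair_unpair]

theorem primrec_argCodes : Primrec argCodes :=
  (Primrec.ofNat (List ℕ)).comp (by fun_prop)

theorem lt_of_mem_argCodes {n m : ℕ} (hn : n.unpair.1 ≠ 0) (hm : m ∈ argCodes n) : m < n := by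
  have h := encode_lt_encode_list_of_mem hm
  rw [argCodes, Denumerable.encode_ofNat, encode_nat] at h
  exact h.trans_le ((Nat.unpair_right_le _).trans (Nat.unpair_right_le _)) |>.trans
    (unpair_snd_lt hn)

theorem primrecPred_mem_range_code : PrimrecPred (· ∈ Set.range code) := by
  classical
  have isApp : PrimrecPred fun n : ℕ => n.unpair.1 = 1 := primrecPred_eq (by fun_prop) (by fun_prop)
  refine primrecPred_of_hereditary
    (q := fun n => n.unpair.1 = 0 ∨ n.unpair.1 = 1 ∧ (argCodes n).length = n.unpair.2.unpair.1)
    (l := fun n => if n.unpair.1 = 1 then argCodes n else []) ?_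
    (Primrec.ite isApp primrec_argCodes (Primrec.const [])) (fun n m hm => ?_) fun n => ?_
  · have := primrec_argCodes
    exact (primrecPred_eq (by fun_prop) (by fun_prop)).or
      (isApp.and (primrecPred_eq (by fun_prop) (by fun_prop)))
  · split_ifs at hm with h
    · exact lt_of_mem_argCodes (by omega) hm
    · simp at hm
  · rw [mem_range_code_iff]
    grind

noncomputable instance : Primcodable Term :=
  primcodableOfInjective code_injective primrecPred_mem_range_code

theorem encode_eq_code (t : Term) : encode t = t.code := rfl

theorem encode_ofFn {k : ℕ} (ts : Fin k → Term) :
    encode (List.ofFn ts) = encode (List.ofFn fun j => (ts j).code) := by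
  rw [encode_list_eq_encode_map, List.map_ofFn]
  rfl

/-- The immediate constituents of a term: the index of a variable, or the index of a function symbol
and the list of arguments. -/
def shape : Term → ℕ ⊕ ℕ × List Term
  | var x => .inl x
  | app _ i ts => .inr (i, List.ofFn ts)

@[fun_prop] theorem primrec_shape : Primrec shape := by
  have isVar : PrimrecPred fun t : Term => (encode t).unpair.1 = 0 :=
    primrecPred_eq (by fun_prop) (by fun_prop)
  have decoded : Primrec fun t : Term => if (encode t).unpair.1 = 0 then
      some (Sum.inl (encode t).unpair.2) else
      (decode (α := ℕ × List Term) (encode t).unpair.2.unpair.2).map Sum.inr :=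
    Primrec.ite isVar (by fun_prop) (by fun_prop)
  refine Primrec.option_some_iff.1 (decoded.of_eq fun t => ?_)
  cases t with
  | var x => simp [encode_eq_code, code, shape]
  | app k i ts =>
    have args : decode (Nat.pair i (encode (List.ofFn fun j => (ts j).code))) =
        some (i, List.ofFn ts) := by
      rw [← encode_ofFn]
      exact encodek (i, List.ofFn ts)
    simp [encode_eq_code, code, shape, args]

@[fun_prop] theorem primrec_var {α : Type*} [Primcodable α] {f : α → ℕ} (hf : Primrec f) :
    Primrec fun a => var (f a) :=
  Primrec.encode_iff.1 (by fun_prop : Primrec fun a => Nat.pair 0 (f a))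

@[fun_prop] theorem primrec_ofList {α : Type*} [Primcodable α] {f : α → ℕ} {g : α → List Term}
    (hf : Primrec f) (hg : Primrec g) : Primrec fun a => ofList (f a) (g a) := by
  have : Primrec fun a => Nat.pair 1 (Nat.pair (g a).length (Nat.pair (f a) (encode (g a)))) := by
    fun_prop
  refine Primrec.encode_iff.1 (this.of_eq fun a => ?_)
  rw [encode_eq_code, code_ofList, encode_list_eq_encode_map]
  rfl

/-- The arguments of the outermost function symbol. -/
def args (t : Term) : List Term := t.shape.elim (fun _ => []) Prod.snd

theorem encode_lt_of_mem_args {s t : Term} (h : s ∈ t.args) : encode s < encode t := by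
  cases t with
  | var x => simp [args, shape] at h
  | app k i ts =>
    obtain ⟨j, rfl⟩ : ∃ j, ts j = s := by simpa [args, shape, eq_comm] using h
    exact lt_of_mem_argCodes (n := (app k i ts).code) (by simp [code])
      (by simp [code, argCodes, encode_eq_code])

theorem primrec_rec {α σ : Type*} [Primcodable α] [Primcodable σ] {f : α → Term → σ}
    {var : α → ℕ → σ} {app : α → ℕ → List σ → σ} (hvar : Primrec fun z : α × ℕ => var z.1 z.2)
    (happ : Primrec fun z : α × ℕ × List σ => app z.1 z.2.1 z.2.2)
    (f_var : ∀ a x, f a (.var x) = var a x)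
    (f_app : ∀ a k i ts, f a (.app k i ts) = app a i (List.ofFn fun j => f a (ts j))) :
    Primrec₂ f := by
  refine Primrec.nat_omega_rec f (m := fun _ t => encode t) (l := fun _ t => t.args)
    (g := fun a z => some (z.1.shape.elim (var a) fun s => app a s.1 z.2)) ?_ ?_ ?_
    (fun _ _ _ => encode_lt_of_mem_args) fun a t => ?_
  · exact Primrec.encode.comp Primrec.snd
  · unfold args Primrec₂
    fun_prop
  · unfold Primrec₂
    fun_prop
  · cases t <;> simp [shape, args, f_var, f_app, Function.comp_def]

end Term

namespace Formula

theorem code_injective : Function.Injective code := by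
  intro φ
  induction φ with
  | const r =>
    intro ψ h
    cases ψ with
    | const s => rw [UnitRat.code_injective (Nat.pair_eq_pair.1 h).2]
    | _ => simp [code] at h
  | rel k i ss =>
    intro ψ h
    cases ψ with
    | rel l j ts =>
      have := @Term.code_injective (.app k i ss) (.app l j ts) h
      simpa using this
    | _ => simp [code] at h
  | imp φ₁ φ₂ ih₁ ih₂ =>
    intro ψ h
    cases ψ with
    | imp ψ₁ ψ₂ =>
      simp only [code, Nat.pair_eq_pair, true_and] at h
      rw [ih₁ h.1, ih₂ h.2]
    | _ => simp [code] at h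
  | all x φ ih =>
    intro ψ h
    cases ψ with
    | all y ψ =>
      simp only [code, Nat.pair_eq_pair, true_and] at h
      rw [h.1, ih h.2]
    | _ => simp [code] at h

theorem mem_range_code_iff (n : ℕ) : n ∈ Set.range code ↔
    n.unpair.1 = 0 ∧ n.unpair.2 ∈ Set.range UnitRat.code ∨
    n.unpair.1 = 1 ∧ n ∈ Set.range Term.code ∨
    n.unpair.1 = 2 ∧ n.unpair.2.unpair.1 ∈ Set.range code ∧ n.unpair.2.unpair.2 ∈ Set.range code ∨
    n.unpair.1 = 3 ∧ n.unpair.2.unpair.2 ∈ Set.range code := by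
  constructor
  · rintro ⟨φ, rfl⟩
    cases φ with
    | rel k i ts => exact .inr (.inl ⟨by simp [code], .app k i ts, rfl⟩)
    | _ => simp [code]
  · rintro (⟨tag, r, hr⟩ | ⟨tag, t, rfl⟩ | ⟨tag, ⟨φ, hφ⟩, ψ, hψ⟩ | ⟨tag, φ, hφ⟩)
    · exact ⟨const r, by rw [code, hr, ← tag, Nat.pair_unpair]⟩
    · cases t with
      | var x => simp [Term.code] at tag
      | app k i ts => exact ⟨rel k i ts, rfl⟩
    · exact ⟨imp φ ψ, by rw [code, hφ, hψ, Nat.pair_unpair, ← tag, Nat.pair_unpair]⟩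
    · exact ⟨all n.unpair.2.unpair.1 φ, by rw [code, hφ, Nat.pair_unpair, ← tag, Nat.pair_unpair]⟩

/-- The codes of the immediate subformulas of the formula coded by `n`. -/
def subformulaCodes (n : ℕ) : List ℕ :=
  if n.unpair.1 = 2 then [n.unpair.2.unpair.1, n.unpair.2.unpair.2]
  else if n.unpair.1 = 3 then [n.unpair.2.unpair.2] else []

theorem lt_of_mem_subformulaCodes {n m : ℕ} (h : m ∈ subformulaCodes n) : m < n := by
  have hl := Nat.unpair_left_le n.unpair.2
  have hr := Nat.unpair_right_le n.unpair.2
  have hn : n.unpair.1 ≠ 0 → n.unpair.2 < n := unpair_snd_lt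
  grind [subformulaCodes]

theorem primrecPred_mem_range_code : PrimrecPred (· ∈ Set.range code) := by
  have tag (k : ℕ) : PrimrecPred fun n : ℕ => n.unpair.1 = k :=
    primrecPred_eq (by fun_prop) (by fun_prop)
  have primrec_subformulaCodes : Primrec subformulaCodes :=
    Primrec.ite (tag 2) (by fun_prop) (Primrec.ite (tag 3) (by fun_prop) (by fun_prop))
  refine primrecPred_of_hereditary ((tag 0).and (UnitRat.primrecPred_mem_range_code.comp
      (by fun_prop : Primrec fun n : ℕ => n.unpair.2)) |>.or <|
    ((tag 1).and Term.primrecPred_mem_range_code).or ((tag 2).or (tag 3)))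
    primrec_subformulaCodes (fun _ _ => lt_of_mem_subformulaCodes) fun n => ?_
  rw [mem_range_code_iff]
  grind [subformulaCodes]

noncomputable instance : Primcodable Formula :=
  primcodableOfInjective code_injective primrecPred_mem_range_code

theorem encode_eq_code (φ : Formula) : encode φ = φ.code := rfl

/-- The immediate constituents of a formula: a truth constant, the index of a relation symbol with
its arguments, the two parts of an implication, or a bound variable with the quantified formula. -/
def shape : Formula → UnitRat ⊕ (ℕ × List Term) ⊕ (Formula × Formula) ⊕ (ℕ × Formula)
  | const r => .inl r
  | rel _ i ts => .inr (.inl (i, List.ofFn ts))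
  | imp φ ψ => .inr (.inr (.inl (φ, ψ)))
  | all x φ => .inr (.inr (.inr (x, φ)))

@[fun_prop] theorem primrec_shape : Primrec shape := by
  have tag (k : ℕ) : PrimrecPred fun φ : Formula => (encode φ).unpair.1 = k :=
    primrecPred_eq (by fun_prop) (by fun_prop)
  let body (φ : Formula) : ℕ := (encode φ).unpair.2
  have hbody : Primrec body := by fun_prop
  have decoded : Primrec fun φ : Formula =>
      if (encode φ).unpair.1 = 0 then (decode (α := UnitRat) (body φ)).map Sum.inl else
      if (encode φ).unpair.1 = 1 then
        (decode (α := ℕ × List Term) (body φ).unpair.2).map (Sum.inr ∘ Sum.inl) else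
      if (encode φ).unpair.1 = 2 then
        (decode (α := Formula × Formula) (body φ)).map (Sum.inr ∘ Sum.inr ∘ Sum.inl) else
      (decode (α := ℕ × Formula) (body φ)).map (Sum.inr ∘ Sum.inr ∘ Sum.inr) := by
    unfold Function.comp
    exact Primrec.ite (tag 0) (by fun_prop) <| Primrec.ite (tag 1) (by fun_prop) <|
      Primrec.ite (tag 2) (by fun_prop) (by fun_prop)
  refine Primrec.option_some_iff.1 (decoded.of_eq fun φ => ?_)
  cases φ with
  | const r =>
    have : decode r.code = some r := encodek r
    simp [body, encode_eq_code, code, shape, this]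
  | rel k i ts =>
    have args : decode (Nat.pair i (encode (List.ofFn fun j => (ts j).code))) =
        some (i, List.ofFn ts) := by
      rw [← Term.encode_ofFn]
      exact encodek (i, List.ofFn ts)
    simp [body, encode_eq_code, code, shape, args]
  | imp φ ψ =>
    have : decode (Nat.pair φ.code ψ.code) = some (φ, ψ) := encodek (φ, ψ)
    simp [body, encode_eq_code, code, shape, this]
  | all x φ =>
    have : decode (Nat.pair x φ.code) = some (x, φ) := encodek (x, φ)
    simp [body, encode_eq_code, code, shape, this]

@[fun_prop] theorem primrec_const {α : Type*} [Primcodable α] {f : α → UnitRat} (hf : Primrec f) :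
    Primrec fun a => const (f a) :=
  Primrec.encode_iff.1 (by fun_prop : Primrec fun a => Nat.pair 0 (encode (f a)))

@[fun_prop] theorem primrec_imp {α : Type*} [Primcodable α] {f g : α → Formula} (hf : Primrec f)
    (hg : Primrec g) : Primrec fun a => imp (f a) (g a) :=
  Primrec.encode_iff.1
    (by fun_prop : Primrec fun a => Nat.pair 2 (Nat.pair (encode (f a)) (encode (g a))))

@[fun_prop] theorem primrec_all {α : Type*} [Primcodable α] {f : α → ℕ} {g : α → Formula}
    (hf : Primrec f) (hg : Primrec g) : Primrec fun a => all (f a) (g a) :=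
  Primrec.encode_iff.1 (by fun_prop : Primrec fun a => Nat.pair 3 (Nat.pair (f a) (encode (g a))))

/-- The atomic formula with relation symbol number `i`, whose arity is the number of arguments. -/
def relOfList (i : ℕ) (ts : List Term) : Formula := rel ts.length i ts.get

theorem relOfList_ofFn {k : ℕ} (i : ℕ) (ts : Fin k → Term) :
    relOfList i (List.ofFn ts) = rel k i ts := by
  apply code_injective
  simp [relOfList, code]

@[fun_prop] theorem primrec_relOfList {α : Type*} [Primcodable α] {f : α → ℕ} {g : α → List Term}
    (hf : Primrec f) (hg : Primrec g) : Primrec fun a => relOfList (f a) (g a) :=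
  Primrec.encode_iff.1
    (by fun_prop : Primrec fun a => encode (Term.ofList (f a) (g a)))

/-- The immediate subformulas of a formula. -/
def subformulas (φ : Formula) : List Formula :=
  φ.shape.elim (fun _ => []) fun s => s.elim (fun _ => []) fun s =>
    s.elim (fun z => [z.1, z.2]) fun z => [z.2]

theorem encode_lt_of_mem_subformulas {φ ψ : Formula} (h : ψ ∈ φ.subformulas) :
    encode ψ < encode φ := by
  refine lt_of_mem_subformulaCodes ?_
  cases φ with
  | imp φ₁ φ₂ =>
    obtain rfl | rfl : ψ = φ₁ ∨ ψ = φ₂ := by simpa [subformulas, shape] using h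
    all_goals simp [subformulaCodes, encode_eq_code, code]
  | all x φ =>
    obtain rfl : ψ = φ := by simpa [subformulas, shape] using h
    simp [subformulaCodes, encode_eq_code, code]
  | _ => simp [subformulas, shape] at h

theorem primrec_rec {α σ : Type*} [Primcodable α] [Primcodable σ] {f : α → Formula → σ}
    {const : α → UnitRat → σ} {rel : α → ℕ → List Term → σ} {imp : α → σ → σ → σ}
    {all : α → ℕ → Formula → σ → σ}
    (hconst : Primrec fun z : α × UnitRat => const z.1 z.2)
    (hrel : Primrec fun z : α × ℕ × List Term => rel z.1 z.2.1 z.2.2)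
    (himp : Primrec fun z : α × σ × σ => imp z.1 z.2.1 z.2.2)
    (hall : Primrec fun z : α × ℕ × Formula × σ => all z.1 z.2.1 z.2.2.1 z.2.2.2)
    (f_const : ∀ a r, f a (.const r) = const a r)
    (f_rel : ∀ a k i ts, f a (.rel k i ts) = rel a i (List.ofFn ts))
    (f_imp : ∀ a φ ψ, f a (.imp φ ψ) = imp a (f a φ) (f a ψ))
    (f_all : ∀ a x φ, f a (.all x φ) = all a x φ (f a φ)) : Primrec₂ f := by
  refine Primrec.nat_omega_rec f (m := fun _ φ => encode φ) (l := fun _ φ => φ.subformulas)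
    (g := fun a z => z.1.shape.elim (fun r => some (const a r)) fun s =>
      s.elim (fun s => some (rel a s.1 s.2)) fun s =>
      s.elim (fun _ => z.2[0]?.bind fun u => z.2[1]?.map fun v => imp a u v) fun s =>
        z.2[0]?.map fun u => all a s.1 s.2 u)
    ?_ ?_ ?_ (fun _ _ _ => encode_lt_of_mem_subformulas) fun a φ => ?_
  · exact Primrec.encode.comp Primrec.snd
  · unfold subformulas Primrec₂
    fun_prop
  · unfold Primrec₂
    fun_prop
  · cases φ <;> simp [shape, subformulas, f_const, f_rel, f_imp, f_all]

end Formula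

section

variable {α β : Type*} [Primcodable α] [Primcodable β]

@[fun_prop] theorem primrec_list_map {f : α → List β} {γ : Type*} [Primcodable γ]
    {g : α → β → γ} (hf : Primrec f)
    (hg : Primrec fun z : α × β => g z.1 z.2) : Primrec fun a => (f a).map (g a) :=
  Primrec.list_map hf hg

@[fun_prop] theorem primrec_list_flatMap {f : α → List β} {γ : Type*} [Primcodable γ]
    {g : α → β → List γ} (hf : Primrec f)
    (hg : Primrec fun z : α × β => g z.1 z.2) : Primrec fun a => (f a).flatMap (g a) :=
  Primrec.list_flatMap hf hg

@[fun_prop] theorem primrec_list_flatten {f : α → List (List β)} (hf : Primrec f) :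
    Primrec fun a => (f a).flatten := Primrec.list_flatten.comp hf

@[fun_prop] theorem primrec_list_append {f g : α → List β} (hf : Primrec f) (hg : Primrec g) :
    Primrec fun a => f a ++ g a := Primrec.list_append.comp hf hg

end

namespace Term

@[fun_prop] theorem primrec_subst {α : Type*} [Primcodable α] {f : α → ℕ} {g h : α → Term}
    (hf : Primrec f) (hg : Primrec g) (hh : Primrec h) :
    Primrec fun a => subst (f a) (g a) (h a) := by
  have : Primrec fun z : (ℕ × Term) × Term => subst z.1.1 z.1.2 z.2 :=
    primrec_rec (f := fun (a : ℕ × Term) t => subst a.1 a.2 t)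
      (var := fun a y => if y = a.1 then a.2 else var y) (app := fun _ i ts => ofList i ts)
      (Primrec.ite (primrecPred_eq (by fun_prop) (by fun_prop)) (by fun_prop) (by fun_prop))
      (by fun_prop) (fun _ _ => rfl) fun _ _ _ _ => by rw [ofList_ofFn, subst]
  exact this.comp ((hf.pair hg).pair hh)

theorem primrecRel_occurs : PrimrecRel fun (x : ℕ) (t : Term) => t.Occurs x := by
  classical
  refine ⟨Classical.decPred _, primrec_rec (f := fun x t => decide (t.Occurs x))
    (var := fun x y => decide (x = y)) (app := fun _ _ bs => decide (true ∈ bs))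
    Primrec.eq.decide ?_ (fun _ _ => decide_eq_decide.2 Iff.rfl)
    fun _ _ _ _ => decide_eq_decide.2 (by simp [Occurs, List.mem_ofFn])⟩
  exact (primrecRel_mem_list.comp (by fun_prop) (by fun_prop)).decide

/-- The function symbols in a term, with repetitions. -/
def funSymbols : Term → List (ℕ × ℕ)
  | var _ => []
  | app k i ts => (k, i) :: (List.ofFn fun j => (ts j).funSymbols).flatten

theorem inLang_iff (L : Lang) (t : Term) : t.InLang L ↔ ∀ s ∈ t.funSymbols, s ∈ L.funs := by
  induction t with
  | var x => simp [InLang, funSymbols]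
  | app k i ts ih =>
    simp only [InLang, funSymbols, ih, List.forall_mem_cons, List.forall_mem_flatten,
      List.forall_mem_ofFn_iff]

@[fun_prop] theorem primrec_funSymbols {α : Type*} [Primcodable α] {f : α → Term}
    (hf : Primrec f) : Primrec fun a => (f a).funSymbols :=
  (primrec_rec (f := fun (_ : Unit) t => t.funSymbols) (var := fun _ _ => [])
    (app := fun _ i l => (l.length, i) :: l.flatten) (by fun_prop) (by fun_prop) (fun _ _ => rfl)
    fun _ k i ts => by simp [funSymbols]).comp (Primrec.const ()) hf

end Term

namespace Formula

theorem primrec_subst : Primrec fun z : (ℕ × Term) × Formula => z.2.subst z.1.1 z.1.2 := by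
  refine primrec_rec (f := fun (a : ℕ × Term) φ => φ.subst a.1 a.2) (const := fun _ r => const r)
    (rel := fun a i ts => relOfList i (ts.map fun t => Term.subst a.1 a.2 t))
    (imp := fun _ φ ψ => imp φ ψ) (all := fun a y φ ψ => if y = a.1 then all y φ else all y ψ)
    (by fun_prop) (by fun_prop) (by fun_prop)
    (Primrec.ite (primrecPred_eq (by fun_prop) (by fun_prop)) (by fun_prop) (by fun_prop))
    (fun _ _ => rfl) (fun a k i ts => ?_) (fun _ _ _ => rfl) (fun _ _ _ => rfl)
  rw [List.map_ofFn, relOfList_ofFn, subst]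
  rfl

theorem primrecRel_free : PrimrecRel fun (x : ℕ) (φ : Formula) => φ.Free x := by
  classical
  have occurs : PrimrecRel fun (ts : List Term) x => ∃ t ∈ ts, t.Occurs x :=
    PrimrecRel.exists_mem_list (Term.primrecRel_occurs.comp Primrec.snd Primrec.fst)
  refine ⟨Classical.decPred _, primrec_rec (f := fun x φ => decide (φ.Free x))
    (const := fun _ _ => decide False) (rel := fun x _ ts => decide (∃ t ∈ ts, t.Occurs x))
    (imp := fun _ b c => decide (b = true ∨ c = true))
    (all := fun x y _ b => decide (x ≠ y ∧ b = true))
    (Primrec.const _) (occurs.comp (by fun_prop) (by fun_prop)).decide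
    ((primrecPred_eq ?_ ?_).or (primrecPred_eq ?_ ?_)).decide
    ((primrecPred_eq ?_ ?_).not.and (primrecPred_eq ?_ ?_)).decide
    (fun _ _ => decide_eq_decide.2 Iff.rfl)
    (fun _ _ _ _ => decide_eq_decide.2 (by simp [Free, List.mem_ofFn]))
    (fun _ _ _ => decide_eq_decide.2 (by simp [Free]))
    fun _ _ _ => decide_eq_decide.2 (by simp [Free])⟩
  all_goals fun_prop

theorem primrecPred_freeFor :
    PrimrecPred fun z : (ℕ × Term) × Formula => z.2.FreeFor z.1.1 z.1.2 := by
  classical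
  have free : PrimrecPred fun z : (ℕ × Term) × ℕ × Formula × Bool =>
      (all z.2.1 z.2.2.1).Free z.1.1 := primrecRel_free.comp (by fun_prop) (by fun_prop)
  have occurs : PrimrecPred fun z : (ℕ × Term) × ℕ × Formula × Bool =>
      z.1.2.Occurs z.2.1 := Term.primrecRel_occurs.comp (by fun_prop) (by fun_prop)
  refine ⟨Classical.decPred _, primrec_rec
    (f := fun (a : ℕ × Term) φ => decide (φ.FreeFor a.1 a.2))
    (const := fun _ _ => decide True) (rel := fun _ _ _ => decide True)
    (imp := fun _ b c => decide (b = true ∧ c = true))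
    (all := fun a y φ b => decide (¬ (all y φ).Free a.1 ∨ (¬ a.2.Occurs y ∧ b = true)))
    (Primrec.const _) (Primrec.const _)
    ((primrecPred_eq ?_ ?_).and (primrecPred_eq ?_ ?_)).decide
    (free.not.or (occurs.not.and (primrecPred_eq ?_ ?_))).decide
    (fun _ _ => decide_eq_decide.2 Iff.rfl) (fun _ _ _ _ => decide_eq_decide.2 Iff.rfl)
    (fun _ _ _ => decide_eq_decide.2 (by simp [FreeFor]))
    fun _ _ _ => decide_eq_decide.2 (by simp [FreeFor])⟩
  all_goals fun_prop

theorem primrecPred_isLukasiewicz : PrimrecPred IsLukasiewicz := by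
  classical
  have isOne : PrimrecPred fun z : Unit × UnitRat => z.2.1 = 1 :=
    (primrecPred_eq Primrec.snd (Primrec.const ⟨1, zero_le_one, le_rfl⟩)).of_eq
      fun _ => Subtype.ext_iff
  refine ⟨Classical.decPred _, (primrec_rec (f := fun (_ : Unit) φ => decide φ.IsLukasiewicz)
    (const := fun _ r => decide (r.1 = 1)) (rel := fun _ _ _ => decide True)
    (imp := fun _ b c => decide (b = true ∧ c = true)) (all := fun _ _ _ b => b)
    isOne.decide (Primrec.const _) ((primrecPred_eq ?_ ?_).and (primrecPred_eq ?_ ?_)).decide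
    (by fun_prop) (fun _ _ => decide_eq_decide.2 Iff.rfl)
    (fun _ _ _ _ => decide_eq_decide.2 Iff.rfl)
    (fun _ _ _ => decide_eq_decide.2 (by simp [IsLukasiewicz]))
    fun _ _ _ => decide_eq_decide.2 Iff.rfl).comp (Primrec.const ()) Primrec.id⟩
  all_goals fun_prop

/-- The function symbols (on the left) and relation symbols (on the right) in a formula, with
repetitions. -/
def symbols : Formula → List (ℕ × ℕ ⊕ ℕ × ℕ)
  | const _ => []
  | rel k i ts => .inr (k, i) :: (List.ofFn ts).flatMap fun t => t.funSymbols.map .inl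
  | imp φ ψ => φ.symbols ++ ψ.symbols
  | all _ φ => φ.symbols

theorem inLang_iff (L : Lang) (φ : Formula) :
    φ.InLang L ↔ ∀ s ∈ φ.symbols, s.elim (· ∈ L.funs) (· ∈ L.rels) := by
  induction φ with
  | const r => simp [InLang, symbols]
  | rel k i ts =>
    simp only [InLang, symbols, Term.inLang_iff, List.forall_mem_cons, List.forall_mem_flatMap,
      List.forall_mem_map, List.forall_mem_ofFn_iff, Sum.elim_inl, Sum.elim_inr]
  | imp φ ψ ihφ ihψ => simp [InLang, symbols, ihφ, ihψ, or_imp, forall_and]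
  | all _ _ ih => exact ih

@[fun_prop] theorem primrec_symbols {α : Type*} [Primcodable α] {f : α → Formula}
    (hf : Primrec f) : Primrec fun a => (f a).symbols :=
  (primrec_rec (f := fun (_ : Unit) φ => φ.symbols) (const := fun _ _ => [])
    (rel := fun _ i ts => .inr (ts.length, i) :: ts.flatMap fun t => t.funSymbols.map .inl)
    (imp := fun _ l m => l ++ m) (all := fun _ _ _ l => l) (by fun_prop) (by fun_prop) (by fun_prop)
    (by fun_prop) (fun _ _ => rfl) (fun _ _ _ _ => by simp [symbols]) (fun _ _ _ => rfl)
    fun _ _ _ => rfl).comp (Primrec.const ()) hf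

end Formula

theorem Term.rePred_inLang {L : Lang} (hL : L.ComputablyGiven) :
    REPred fun t : Term => t.InLang L :=
  (rePred_comp (rePred_forall_mem_list hL.1.to_re)
    (Term.primrec_funSymbols Primrec.id).to_comp).of_eq fun t => (t.inLang_iff L).symm

theorem Formula.rePred_inLang {L : Lang} (hL : L.ComputablyGiven) :
    REPred fun φ : Formula => φ.InLang L := by
  have symbol : REPred fun s : ℕ × ℕ ⊕ ℕ × ℕ => s.elim (· ∈ L.funs) (· ∈ L.rels) := by
    refine (rePred_or (rePred_image hL.1.to_re Primrec.sumInl)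
      (rePred_image hL.2.to_re Primrec.sumInr)).of_eq fun s => ?_
    cases s <;> simp
  exact (rePred_comp (rePred_forall_mem_list symbol)
    (Formula.primrec_symbols Primrec.id).to_comp).of_eq fun φ => (φ.inLang_iff L).symm

theorem Formula.rePred_iff_code {P : Formula → Prop} :
    REPred P ↔ REPred fun n => ∃ φ, P φ ∧ φ.code = n :=
  ⟨fun h => rePred_image h Primrec.encode, fun h =>
    (rePred_comp h Computable.encode).of_eq fun φ =>
      ⟨fun ⟨_, hψ, e⟩ => code_injective e ▸ hψ, fun hφ => ⟨φ, hφ, rfl⟩⟩⟩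

theorem UnitRat.primrecPred_eq_tsub :
    PrimrecPred fun z : UnitRat × UnitRat × UnitRat => z.1 = tsub z.2.1 z.2.2 := by
  refine PrimrecPred.of_eq ?_ fun z => (eq_tsub_iff z.1 z.2.1 z.2.2).symm
  simp only [← encode_eq_code]
  exact primrecPred_eq (by fun_prop) (by fun_prop)

open Formula in
/-- The instances over the language `L` of the axiom schemes of propositional Łukasiewicz logic. -/
inductive PropositionalAxiom (L : Lang) : Formula → Prop
  | weakening {φ ψ} : φ.InLang L → ψ.InLang L → PropositionalAxiom L (imp φ (imp ψ φ))
  | trans {φ ψ σ} : φ.InLang L → ψ.InLang L → σ.InLang L →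
      PropositionalAxiom L (imp (imp φ ψ) (imp (imp ψ σ) (imp φ σ)))
  | or_comm {φ ψ} : φ.InLang L → ψ.InLang L →
      PropositionalAxiom L (imp (imp (imp φ ψ) ψ) (imp (imp ψ φ) φ))
  | contraposition {φ ψ} : φ.InLang L → ψ.InLang L →
      PropositionalAxiom L (imp (imp (imp φ bot) (imp ψ bot)) (imp ψ φ))

open Formula in
theorem PropositionalAxiom.rePred {L : Lang} (hL : L.ComputablyGiven) :
    REPred (PropositionalAxiom L) := by
  have pair : REPred fun z : Formula × Formula => z.1.InLang L ∧ z.2.InLang L :=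
    rePred_and (rePred_comp (Formula.rePred_inLang hL) Computable.fst)
      (rePred_comp (Formula.rePred_inLang hL) Computable.snd)
  have triple : REPred fun z : Formula × Formula × Formula =>
      z.1.InLang L ∧ z.2.1.InLang L ∧ z.2.2.InLang L :=
    rePred_and (rePred_comp (Formula.rePred_inLang hL) Computable.fst)
      (rePred_comp pair Computable.snd)
  have weakening := rePred_image pair (f := fun z => imp z.1 (imp z.2 z.1)) (by fun_prop)
  have trans := rePred_image triple
    (f := fun z => imp (imp z.1 z.2.1) (imp (imp z.2.1 z.2.2) (imp z.1 z.2.2))) (by fun_prop)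
  have or_comm := rePred_image pair
    (f := fun z => imp (imp (imp z.1 z.2) z.2) (imp (imp z.2 z.1) z.1)) (by fun_prop)
  have contraposition := rePred_image pair
    (f := fun z => imp (imp (imp z.1 bot) (imp z.2 bot)) (imp z.2 z.1)) (by fun_prop)
  refine (rePred_or (rePred_or weakening trans) (rePred_or or_comm contraposition)).of_eq
    fun χ => ⟨?_, ?_⟩
  · rintro ((⟨z, ⟨h₁, h₂⟩, rfl⟩ | ⟨z, ⟨h₁, h₂, h₃⟩, rfl⟩) |
      (⟨z, ⟨h₁, h₂⟩, rfl⟩ | ⟨z, ⟨h₁, h₂⟩, rfl⟩))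
    exacts [.weakening h₁ h₂, .trans h₁ h₂ h₃, .or_comm h₁ h₂, .contraposition h₁ h₂]
  · rintro (⟨h₁, h₂⟩ | ⟨h₁, h₂, h₃⟩ | ⟨h₁, h₂⟩ | ⟨h₁, h₂⟩)
    exacts [.inl (.inl ⟨(_, _), ⟨h₁, h₂⟩, rfl⟩), .inl (.inr ⟨(_, _, _), ⟨h₁, h₂, h₃⟩, rfl⟩),
      .inr (.inl ⟨(_, _), ⟨h₁, h₂⟩, rfl⟩), .inr (.inr ⟨(_, _), ⟨h₁, h₂⟩, rfl⟩)]

open Formula in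
/-- The instances over the language `L` of the two axiom schemes for the universal quantifier. -/
inductive QuantifierAxiom (L : Lang) : Formula → Prop
  | specialization {φ x t} : φ.InLang L → t.InLang L → φ.FreeFor x t →
      QuantifierAxiom L (imp (all x φ) (φ.subst x t))
  | distribution {φ ψ x} : φ.InLang L → ψ.InLang L → ¬ φ.Free x →
      QuantifierAxiom L (imp (all x (imp φ ψ)) (imp φ (all x ψ)))

open Formula in
theorem QuantifierAxiom.rePred {L : Lang} (hL : L.ComputablyGiven) :
    REPred (QuantifierAxiom L) := by
  have inLang {α : Type} [Primcodable α] {f : α → Formula} (hf : Primrec f) :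
      REPred fun a => (f a).InLang L := rePred_comp (Formula.rePred_inLang hL) hf.to_comp
  have substitutable : REPred fun z : (ℕ × Term) × Formula =>
      z.2.InLang L ∧ z.1.2.InLang L ∧ z.2.FreeFor z.1.1 z.1.2 :=
    rePred_and (inLang (by fun_prop)) <| rePred_and
      (rePred_comp (Term.rePred_inLang hL) (Computable.snd.comp Computable.fst))
      Formula.primrecPred_freeFor.computablePred.to_re
  have notFree : REPred fun z : ℕ × Formula × Formula =>
      z.2.1.InLang L ∧ z.2.2.InLang L ∧ ¬ z.2.1.Free z.1 :=
    rePred_and (inLang (by fun_prop)) <| rePred_and (inLang (by fun_prop)) <|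
      (Formula.primrecRel_free.comp Primrec.fst
        (Primrec.fst.comp Primrec.snd)).not.computablePred.to_re
  have primrec_subst := Formula.primrec_subst
  have specialization := rePred_image substitutable
    (f := fun z => imp (all z.1.1 z.2) (z.2.subst z.1.1 z.1.2)) (by fun_prop)
  have distribution := rePred_image notFree
    (f := fun z => imp (all z.1 (imp z.2.1 z.2.2)) (imp z.2.1 (all z.1 z.2.2))) (by fun_prop)
  refine (rePred_or specialization distribution).of_eq fun χ => ⟨?_, ?_⟩
  · rintro (⟨z, ⟨h₁, h₂, h₃⟩, rfl⟩ | ⟨z, ⟨h₁, h₂, h₃⟩, rfl⟩)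
    exacts [.specialization h₁ h₂ h₃, .distribution h₁ h₂ h₃]
  · rintro (⟨h₁, h₂, h₃⟩ | ⟨h₁, h₂, h₃⟩)
    exacts [.inl ⟨((_, _), _), ⟨h₁, h₂, h₃⟩, rfl⟩, .inr ⟨(_, _, _), ⟨h₁, h₂, h₃⟩, rfl⟩]

/-- The axiom relating the truth constants `r`, `s` and `s ∸ r`. -/
def bookkeepingAxiom (r s : UnitRat) : Formula :=
  .iff (.imp (.const r) (.const s)) (.const (UnitRat.tsub s r))

theorem rePred_bookkeepingAxiom : REPred fun χ => ∃ r s, bookkeepingAxiom r s = χ := by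
  refine (rePred_image UnitRat.primrecPred_eq_tsub.computablePred.to_re
    (f := fun z => .iff (.imp (.const z.2.2) (.const z.2.1)) (.const z.1)) ?_).of_eq
      fun χ => ⟨?_, ?_⟩
  · unfold Formula.iff Formula.oplus Formula.neg
    fun_prop
  · rintro ⟨z, h, rfl⟩
    exact ⟨z.2.2, z.2.1, by rw [bookkeepingAxiom, h]⟩
  · rintro ⟨r, s, rfl⟩
    exact ⟨(UnitRat.tsub s r, s, r), rfl, rfl⟩

/-- The axioms and rules of proof in `T`, as a relation between lists of premises and
conclusions. -/
inductive ProofRule (T : Theory) : List Formula → Formula → Prop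
  | hyp {φ} : φ ∈ T.axioms → ProofRule T [] φ
  | propositional {φ} : PropositionalAxiom T.lang φ → ProofRule T [] φ
  | quantifier {φ} : QuantifierAxiom T.lang φ → ProofRule T [] φ
  | bookkeeping (r s) : ProofRule T [] (bookkeepingAxiom r s)
  | mp (φ ψ) : ProofRule T [φ, .imp φ ψ] ψ
  | gen (x φ) : ProofRule T [φ] (.all x φ)

open Formula in
theorem ProofRule.rePred {T : Theory} (hT : T.ComputablyAxiomatizable) :
    REPred fun r : List Formula × Formula => ProofRule T r.1 r.2 := by
  have isAxiom : REPred fun φ => φ ∈ T.axioms ∨ PropositionalAxiom T.lang φ ∨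
      QuantifierAxiom T.lang φ ∨ ∃ r s, bookkeepingAxiom r s = φ :=
    rePred_or (Formula.rePred_iff_code.2 hT.2) <| rePred_or (PropositionalAxiom.rePred hT.1) <|
      rePred_or (QuantifierAxiom.rePred hT.1) rePred_bookkeepingAxiom
  have always {α : Type} [Primcodable α] : REPred fun _ : α => True :=
    (PrimrecPred.computablePred ⟨inferInstance, Primrec.const true⟩).to_re
  have leaf := rePred_image isAxiom (f := fun φ => (([] : List Formula), φ)) (by fun_prop)
  have mp := rePred_image (always (α := Formula × Formula))
    (f := fun z => ([z.1, imp z.1 z.2], z.2)) (by fun_prop)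
  have gen := rePred_image (always (α := ℕ × Formula)) (f := fun z => ([z.2], all z.1 z.2))
    (by fun_prop)
  refine (rePred_or leaf (rePred_or mp gen)).of_eq fun ⟨ps, φ⟩ => ⟨?_, ?_⟩
  · rintro (⟨φ, h | h | h | ⟨r, s, rfl⟩, ⟨⟩⟩ | ⟨z, -, ⟨⟩⟩ | ⟨z, -, ⟨⟩⟩)
    exacts [.hyp h, .propositional h, .quantifier h, .bookkeeping r s, .mp _ _, .gen _ _]
  · dsimp only
    rintro (h | h | h | ⟨r, s⟩ | φ | ⟨x, φ⟩)
    exacts [.inl ⟨_, .inl h, rfl⟩, .inl ⟨_, .inr (.inl h), rfl⟩,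
      .inl ⟨_, .inr (.inr (.inl h)), rfl⟩, .inl ⟨_, .inr (.inr (.inr ⟨r, s, rfl⟩)), rfl⟩,
      .inr (.inl ⟨(_, _), trivial, rfl⟩), .inr (.inr ⟨(_, _), trivial, rfl⟩)]

theorem Theory.proves_iff_derivable (T : Theory) (φ : Formula) :
    T.Proves φ ↔ Derivable (ProofRule T) φ := by
  constructor
  · intro h
    have leaf {χ} (h : ProofRule T [] χ) : Derivable (ProofRule T) χ := .intro h (by simp)
    induction h with
    | hyp hφ _ => exact leaf (.hyp hφ)
    | ax1 h₁ h₂ => exact leaf (.propositional (.weakening h₁ h₂))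
    | ax2 h₁ h₂ h₃ => exact leaf (.propositional (.trans h₁ h₂ h₃))
    | ax3 h₁ h₂ => exact leaf (.propositional (.or_comm h₁ h₂))
    | ax4 h₁ h₂ => exact leaf (.propositional (.contraposition h₁ h₂))
    | all1 h₁ h₂ h₃ => exact leaf (.quantifier (.specialization h₁ h₂ h₃))
    | all2 h₁ h₂ h₃ => exact leaf (.quantifier (.distribution h₁ h₂ h₃))
    | axR r s => exact leaf (.bookkeeping r s)
    | mp _ _ ih₁ ih₂ => exact .intro (.mp _ _) (by simpa using ⟨ih₁, ih₂⟩)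
    | gen x _ ih => exact .intro (.gen x _) (List.forall_mem_singleton.2 ih)
  · intro h
    induction h with
    | intro hrule _ ih =>
      cases hrule with
      | hyp h => exact .hyp h (T.inLang _ h)
      | propositional h =>
        rcases h with ⟨h₁, h₂⟩ | ⟨h₁, h₂, h₃⟩ | ⟨h₁, h₂⟩ | ⟨h₁, h₂⟩
        exacts [.ax1 h₁ h₂, .ax2 h₁ h₂ h₃, .ax3 h₁ h₂, .ax4 h₁ h₂]
      | quantifier h =>
        rcases h with ⟨h₁, h₂, h₃⟩ | ⟨h₁, h₂, h₃⟩
        exacts [.all1 h₁ h₂ h₃, .all2 h₁ h₂ h₃]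
      | bookkeeping r s => exact .axR r s
      | mp φ => exact .mp (ih φ (by simp)) (ih (.imp φ _) (by simp))
      | gen x φ => exact .gen x (ih φ (by simp))

theorem Theory.ComputablyAxiomatizable.rePred_proves {T : Theory}
    (hT : T.ComputablyAxiomatizable) : REPred T.Proves :=
  (Derivable.rePred (ProofRule.rePred hT)).of_eq fun φ => (T.proves_iff_derivable φ).symm

theorem Term.subst_of_not_occurs {x : ℕ} (u : Term) {t : Term} (h : ¬ t.Occurs x) :
    Term.subst x u t = t := by
  induction t with
  | var y => exact if_neg fun e : y = x => h e.symm
  | app k i ts ih => exact congrArg (app k i) (funext fun j => ih j fun hj => h ⟨j, hj⟩)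

theorem Formula.subst_of_not_free {x : ℕ} (u : Term) {φ : Formula} (h : ¬ φ.Free x) :
    φ.subst x u = φ := by
  induction φ with
  | const r => rfl
  | rel k i ts =>
    exact congrArg (rel k i) (funext fun j => Term.subst_of_not_occurs u fun hj => h ⟨j, hj⟩)
  | imp φ ψ ih₁ ih₂ =>
    exact congrArg₂ imp (ih₁ fun hφ => h (.inl hφ)) (ih₂ fun hψ => h (.inr hψ))
  | all y φ ih =>
    by_cases hy : y = x
    · exact if_pos hy
    · rw [subst, if_neg hy, ih fun hφ => h ⟨Ne.symm hy, hφ⟩]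

section Soundness

variable {M : Type*} (S : Interp M)

theorem Term.eval_congr {t : Term} {v w : ℕ → M} (h : ∀ x, t.Occurs x → v x = w x) :
    t.eval S v = t.eval S w := by
  induction t with
  | var x => exact h x rfl
  | app k i ts ih =>
    exact congrArg (S.fn k i) (funext fun j => ih j fun x hx => h x ⟨j, hx⟩)

theorem Term.eval_subst (x : ℕ) (s t : Term) (v : ℕ → M) :
    (Term.subst x s t).eval S v = t.eval S (Function.update v x (s.eval S v)) := by
  induction t with
  | var y =>
    by_cases h : y = x
    · simp [subst, eval, h]
    · simp [subst, eval, h]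
  | app k i ts ih => exact congrArg (S.fn k i) (funext ih)

namespace Formula

theorem eval_congr {φ : Formula} {v w : ℕ → M} (h : ∀ x, φ.Free x → v x = w x) :
    φ.eval S v = φ.eval S w := by
  induction φ generalizing v w with
  | const r => rfl
  | rel k i ts =>
    exact congrArg (fun a => (S.rel k i a : ℝ))
      (funext fun j => Term.eval_congr S fun x hx => h x ⟨j, hx⟩)
  | imp φ ψ ih₁ ih₂ =>
    simp only [eval, ih₁ fun x hx => h x (.inl hx), ih₂ fun x hx => h x (.inr hx)]
  | all y φ ih =>
    refine congrArg iSup (funext fun a => ih fun x hx => ?_)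
    by_cases hxy : x = y
    · simp [hxy]
    · simp [hxy, h x ⟨hxy, hx⟩]

theorem IsSentence.eval_eq {φ : Formula} (h : φ.IsSentence) (v w : ℕ → M) :
    φ.eval S v = φ.eval S w :=
  eval_congr S fun x hx => absurd hx (h x)

theorem eval_update_of_not_free {φ : Formula} {x : ℕ} (h : ¬ φ.Free x) (v : ℕ → M) (a : M) :
    φ.eval S (Function.update v x a) = φ.eval S v :=
  eval_congr S fun _ hy => Function.update_of_ne (by rintro rfl; exact h hy) _ _

theorem eval_subst {x : ℕ} {s : Term} {φ : Formula} (h : φ.FreeFor x s) (v : ℕ → M) :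
    (φ.subst x s).eval S v = φ.eval S (Function.update v x (s.eval S v)) := by
  induction φ generalizing v with
  | const r => rfl
  | rel k i ts =>
    exact congrArg (fun a => (S.rel k i a : ℝ)) (funext fun j => Term.eval_subst S x s (ts j) v)
  | imp φ ψ ih₁ ih₂ => simp only [subst, eval, ih₁ h.1, ih₂ h.2]
  | all y φ ih =>
    by_cases free : (all y φ).Free x
    · obtain ⟨not_captured, hs⟩ := h.resolve_left fun h' => h' free
      have hne : y ≠ x := free.1.symm
      rw [subst, if_neg hne]
      refine congrArg iSup (funext fun a => ?_)
      have hv : s.eval S (Function.update v y a) = s.eval S v :=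
        Term.eval_congr S fun z hz =>
          Function.update_of_ne (by rintro rfl; exact not_captured hz) _ _
      rw [ih hs, Function.update_comm hne, hv]
    · rw [subst_of_not_free _ free, eval_update_of_not_free S free]

theorem eval_imp_eq_zero_iff (φ ψ : Formula) (v : ℕ → M) :
    (imp φ ψ).eval S v = 0 ↔ ψ.eval S v ≤ φ.eval S v := by
  rw [eval, max_eq_right_iff, sub_nonpos]

theorem eval_bot (v : ℕ → M) : bot.eval S v = 1 := by simp [bot, eval]

variable [Nonempty M]

theorem eval_mem_Icc (φ : Formula) (v : ℕ → M) : φ.eval S v ∈ Set.Icc (0 : ℝ) 1 := by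
  induction φ generalizing v with
  | const r => exact ⟨Rat.cast_nonneg.2 r.2.1, (Rat.cast_le.2 r.2.2).trans_eq Rat.cast_one⟩
  | rel k i ts => exact (S.rel k i _).2
  | imp φ ψ ih₁ ih₂ =>
    exact ⟨le_max_right _ _, max_le (by linarith [(ih₁ v).1, (ih₂ v).2]) zero_le_one⟩
  | all x φ ih => exact ⟨Real.iSup_nonneg fun a => (ih _).1, ciSup_le fun a => (ih _).2⟩

theorem eval_neg (φ : Formula) (v : ℕ → M) : φ.neg.eval S v = 1 - φ.eval S v := by
  rw [neg, eval, eval_bot, max_eq_left (sub_nonneg.2 (φ.eval_mem_Icc S v).2)]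

theorem eval_update_le_eval_all (φ : Formula) (v : ℕ → M) (x : ℕ) (a : M) :
    φ.eval S (Function.update v x a) ≤ (all x φ).eval S v :=
  le_ciSup (f := fun a => φ.eval S (Function.update v x a))
    ⟨1, by rintro _ ⟨a, rfl⟩; exact (φ.eval_mem_Icc S _).2⟩ a

theorem eval_all_le_eval_all_imp_add {φ : Formula} (ψ : Formula) {x : ℕ} (h : ¬ φ.Free x)
    (v : ℕ → M) : (all x ψ).eval S v ≤ (all x (imp φ ψ)).eval S v + φ.eval S v := by
  refine ciSup_le fun a => ?_
  have hle := eval_update_le_eval_all S (imp φ ψ) v x a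
  rw [eval, eval_update_of_not_free S h] at hle
  linarith [le_max_left (ψ.eval S (Function.update v x a) - φ.eval S v) 0]

end Formula

theorem eval_bookkeepingAxiom (r s : UnitRat) (v : ℕ → M) :
    (bookkeepingAxiom r s).eval S v = 0 := by
  simp [bookkeepingAxiom, UnitRat.tsub, Formula.iff, Formula.oplus, Formula.neg, Formula.eval,
    Formula.eval_bot]

variable [Nonempty M]

theorem PropositionalAxiom.eval_eq_zero {L : Lang} {φ : Formula} (h : PropositionalAxiom L φ)
    (v : ℕ → M) : φ.eval S v = 0 := by
  have mem_Icc := fun φ : Formula => φ.eval_mem_Icc S v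
  simp only [Set.mem_Icc] at mem_Icc
  cases h <;> simp only [Formula.eval, Formula.eval_bot] <;> grind

theorem QuantifierAxiom.eval_eq_zero {L : Lang} {φ : Formula} (h : QuantifierAxiom L φ)
    (v : ℕ → M) : φ.eval S v = 0 := by
  cases h with
  | @specialization φ x t _ _ hfree =>
    rw [Formula.eval_imp_eq_zero_iff, Formula.eval_subst S hfree]
    exact φ.eval_update_le_eval_all S v x _
  | @distribution φ ψ x _ _ hfree =>
    rw [Formula.eval_imp_eq_zero_iff]
    exact max_le (by linarith [Formula.eval_all_le_eval_all_imp_add S ψ hfree v])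
      (Formula.eval_mem_Icc S _ v).1

theorem ProofRule.eval_eq_zero {T : Theory} (hT : ∀ φ ∈ T.axioms, ∀ v, φ.eval S v = 0)
    {ps : List Formula} {φ : Formula} (h : ProofRule T ps φ)
    (hps : ∀ ψ ∈ ps, ∀ v, ψ.eval S v = 0) (v : ℕ → M) : φ.eval S v = 0 := by
  cases h with
  | hyp h => exact hT _ h v
  | propositional h => exact h.eval_eq_zero S v
  | quantifier h => exact h.eval_eq_zero S v
  | bookkeeping r s => exact eval_bookkeepingAxiom S r s v
  | mp ψ =>
    have hψ := hps ψ (by simp) v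
    have himp := (Formula.eval_imp_eq_zero_iff S _ _ v).1 (hps (.imp ψ φ) (by simp) v)
    exact le_antisymm (himp.trans hψ.le) (φ.eval_mem_Icc S v).1
  | gen x φ => simp [Formula.eval, hps φ (by simp)]

theorem Theory.Proves.eval_eq_zero {T : Theory} (hT : ∀ φ ∈ T.axioms, ∀ v, φ.eval S v = 0)
    {φ : Formula} (h : T.Proves φ) (v : ℕ → M) : φ.eval S v = 0 := by
  rw [T.proves_iff_derivable] at h
  induction h generalizing v with
  | intro hrule _ ih => exact hrule.eval_eq_zero S hT ih v

theorem Theory.consistent_of_eval_eq_zero {T : Theory}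
    (hT : ∀ φ ∈ T.axioms, ∀ v, φ.eval S v = 0) : T.Consistent := fun h => by
  have v : ℕ → M := fun _ => Classical.arbitrary M
  exact one_ne_zero ((Formula.eval_bot S v).symm.trans (Theory.Proves.eval_eq_zero S hT h v))

end Soundness

section Inseparability

/-- Two predicates, usually disjoint and recursively enumerable, that no decidable predicate
separates. -/
def RecursivelyInseparable (A B : ℕ → Prop) : Prop :=
  ¬ ∃ C : ℕ → Prop, ComputablePred C ∧ (∀ n, A n → C n) ∧ ∀ n, B n → ¬ C n

theorem computable_of_forall_dom {f : ℕ →. Bool} (hf : Partrec f) (hdom : ∀ n, (f n).Dom) :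
    Computable fun n => (f n).get (hdom n) :=
  hf.of_eq fun n => (Part.some_get (hdom n)).symm

theorem RecursivelyInseparable.exists_of_rePred_cover {A B U V : ℕ → Prop}
    (hAB : RecursivelyInseparable A B) (hU : REPred U) (hV : REPred V)
    (cover : ∀ n, U n ∨ V n) : (∃ n, A n ∧ V n) ∨ ∃ n, B n ∧ U n := by
  by_contra! h
  obtain ⟨f, hf, hfUV⟩ := Partrec.merge' (hU.map (Computable.const true).to₂)
    (hV.map (Computable.const false).to₂)
  have hdom : ∀ n, (f n).Dom := fun n => by
    rw [(hfUV n).2]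
    simpa [Part.assert] using cover n
  have correct : ∀ n, if (f n).get (hdom n) then U n else V n := fun n => by
    have := (hfUV n).1 _ (Part.get_mem (hdom n))
    simp only [Part.mem_map_iff, Part.mem_assert_iff] at this
    rcases this with ⟨_, ⟨hu, -⟩, hb⟩ | ⟨_, ⟨hv, -⟩, hb⟩
    · simpa [← hb] using hu
    · simpa [← hb] using hv
  refine hAB ⟨fun n => (f n).get (hdom n),
    ComputablePred.computable_iff.2 ⟨_, computable_of_forall_dom hf hdom, rfl⟩, ?_, ?_⟩
  · intro n hA
    by_contra hn
    exact h.1 n hA (by simpa [hn] using correct n)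
  · intro n hB hn
    exact h.2 n hB (by simpa [hn] using correct n)

open Nat.Partrec (Code)

/-- The program with number `n` halts with output `k` when given its own number as input. -/
def SelfOutput (k n : ℕ) : Prop := k ∈ (Denumerable.ofNat Code n).eval n

theorem rePred_selfOutput (k : ℕ) : REPred (SelfOutput k) := by
  have run : Partrec fun n : ℕ => (Denumerable.ofNat Code n).eval n :=
    Code.eval_part.comp (Computable.ofNat Code) Computable.id
  have check : REPred fun z : ℕ × ℕ => z.2 = k :=
    (Primrec.eq.comp Primrec.snd (Primrec.const k)).computablePred.to_re
  have accept : Partrec fun n : ℕ => ((Denumerable.ofNat Code n).eval n).bind fun m =>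
      Part.assert (m = k) fun _ => Part.some () := run.bind check
  refine accept.dom_re.of_eq fun n => ?_
  simp [SelfOutput, Part.assert, Part.dom_iff_mem]

theorem not_selfOutput {k l n : ℕ} (hkl : k ≠ l) (hk : SelfOutput k n) : ¬ SelfOutput l n :=
  fun hl => hkl (Part.mem_unique hk hl)

/-- A decider for a separating set, with its answers exchanged, contradicts the separation at its
own number. -/
theorem recursivelyInseparable_selfOutput (k l : ℕ) :
    RecursivelyInseparable (SelfOutput k) (SelfOutput l) := by
  rintro ⟨C, hC, hk, hl⟩
  obtain ⟨f, hf, rfl⟩ := ComputablePred.computable_iff.1 hC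
  obtain ⟨c, hc⟩ := Code.exists_code.1 <| Partrec.nat_iff.1 <|
    (Computable.cond hf (Computable.const l) (Computable.const k)).partrec
  have output : SelfOutput (bif f (encode c) then l else k) (encode c) := by
    simp [SelfOutput, hc]
  by_cases h : f (encode c)
  · exact hl _ (by simpa [h] using output) h
  · exact h (hk _ (by simpa [h] using output))

end Inseparability

/-- The language with constants `c₀, c₁, …` and a single unary relation symbol. -/
def constLang : Lang where
  funs := {p | p.1 = 0}
  rels := {(1, 0)}

theorem constLang_computablyGiven : constLang.ComputablyGiven :=
  ⟨(Primrec.eq.comp Primrec.fst (Primrec.const 0)).computablePred,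
    (Primrec.eq.comp Primrec.id (Primrec.const (1, 0))).computablePred⟩

/-- The unary relation symbol of `constLang` applied to the constant `cₙ`. -/
def atom (n : ℕ) : Formula := .rel 1 0 fun _ => .app 0 n Fin.elim0

theorem atom_inLang (n : ℕ) : (atom n).InLang constLang :=
  ⟨rfl, fun _ => ⟨rfl, fun j => j.elim0⟩⟩

theorem atom_isSentence (n : ℕ) : (atom n).IsSentence := fun _ ⟨_, j, _⟩ => j.elim0

theorem primrec_atom : Primrec atom := by
  have ofList : ∀ n, Formula.relOfList 0 [Term.ofList n []] = atom n := fun n => by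
    rw [atom, ← Term.ofList_ofFn]
    exact Formula.relOfList_ofFn 0 fun _ : Fin 1 => _
  exact Primrec.of_eq (by fun_prop) ofList

/-- The theory over `constLang` saying that the relation holds of `cₙ` if `A n`, that it fails for
`cₙ` if `B n`, and that excluded middle holds for the formulas of Łukasiewicz logic. -/
def separationTheory (A B : ℕ → Prop) : Theory where
  lang := constLang
  axioms := {φ | (∃ n, A n ∧ atom n = φ) ∨ (∃ n, B n ∧ (atom n).neg = φ) ∨
    ∃ ψ : Formula, (ψ.InLang constLang ∧ ψ.IsLukasiewicz) ∧ ψ.or ψ.neg = φ}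
  inLang := by
    rintro _ (⟨n, -, rfl⟩ | ⟨n, -, rfl⟩ | ⟨ψ, ⟨h, -⟩, rfl⟩)
    · exact atom_inLang n
    · exact ⟨atom_inLang n, trivial⟩
    · exact ⟨⟨h, h, trivial⟩, h, trivial⟩

namespace separationTheory

variable {A B : ℕ → Prop}

theorem atom_mem_axioms {n : ℕ} (h : A n) : atom n ∈ (separationTheory A B).axioms :=
  .inl ⟨n, h, rfl⟩

theorem neg_atom_mem_axioms {n : ℕ} (h : B n) : (atom n).neg ∈ (separationTheory A B).axioms :=
  .inr (.inl ⟨n, h, rfl⟩)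

theorem computablyAxiomatizable (hA : REPred A) (hB : REPred B) :
    (separationTheory A B).ComputablyAxiomatizable := by
  have isLukasiewicz : REPred fun ψ : Formula => ψ.InLang constLang ∧ ψ.IsLukasiewicz :=
    rePred_and (Formula.rePred_inLang constLang_computablyGiven)
      Formula.primrecPred_isLukasiewicz.computablePred.to_re
  have atoms := rePred_image hA primrec_atom
  have negAtoms := rePred_image hB (f := fun n => (atom n).neg) <| by
    have := primrec_atom
    unfold Formula.neg
    fun_prop
  have excludedMiddle := rePred_image isLukasiewicz (f := fun ψ => ψ.or ψ.neg) <| by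
    unfold Formula.or Formula.neg
    fun_prop
  exact ⟨constLang_computablyGiven,
    Formula.rePred_iff_code.1 (rePred_or atoms (rePred_or negAtoms excludedMiddle))⟩

theorem isLukasiewicz : (separationTheory A B).IsLukasiewicz := by
  rintro _ (⟨n, -, rfl⟩ | ⟨n, -, rfl⟩ | ⟨ψ, ⟨-, h⟩, rfl⟩)
  · trivial
  · exact ⟨trivial, rfl⟩
  · exact ⟨⟨h, h, rfl⟩, h, rfl⟩

theorem classical : (separationTheory A B).Classical := fun φ h h' =>
  .hyp (.inr (.inr ⟨φ, ⟨h, h'⟩, rfl⟩)) ⟨⟨h, h, trivial⟩, h, trivial⟩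

end separationTheory

open Classical in
/-- The two-valued structure on the natural numbers in which the constant `cₙ` denotes `n` and the
unary relation holds of the numbers `n` with `A n`. -/
noncomputable def crispInterp (A : ℕ → Prop) : Interp ℕ where
  fn _ n _ := n
  rel _ _ a := if ∃ j, A (a j) then 0 else 1

section crispInterp

variable (A : ℕ → Prop)

open Classical in
theorem eval_atom_crispInterp (n : ℕ) (v : ℕ → ℕ) :
    (atom n).eval (crispInterp A) v = if A n then 0 else 1 := by
  by_cases h : A n <;> simp [atom, Formula.eval, Term.eval, crispInterp, h]

theorem eval_crispInterp_eq_zero_or_one {φ : Formula} (hφ : φ.IsLukasiewicz) (v : ℕ → ℕ) :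
    φ.eval (crispInterp A) v = 0 ∨ φ.eval (crispInterp A) v = 1 := by
  induction φ generalizing v with
  | const r =>
    have hr : r.1 = 1 := hφ
    simp [Formula.eval, hr]
  | rel k i ts =>
    simp only [Formula.eval, crispInterp]
    split_ifs <;> simp
  | imp φ ψ ih₁ ih₂ =>
    rcases ih₁ hφ.1 v with h | h <;> rcases ih₂ hφ.2 v with h' | h' <;> simp [Formula.eval, h, h']
  | all x φ ih =>
    by_cases h : ∃ a, φ.eval (crispInterp A) (Function.update v x a) = 1
    · obtain ⟨a, ha⟩ := h
      exact .inr (le_antisymm (Formula.eval_mem_Icc _ _ v).2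
        (ha ▸ φ.eval_update_le_eval_all _ v x a))
    · have zero : ∀ a, φ.eval (crispInterp A) (Function.update v x a) = 0 := fun a =>
        (ih hφ _).resolve_right fun ha => h ⟨a, ha⟩
      exact .inl (by simp [Formula.eval, zero])

end crispInterp

theorem separationTheory.consistent {A B : ℕ → Prop} (hAB : ∀ n, A n → ¬ B n) :
    (separationTheory A B).Consistent := by
  refine Theory.consistent_of_eval_eq_zero (crispInterp A) ?_
  rintro _ (⟨n, hA, rfl⟩ | ⟨n, hB, rfl⟩ | ⟨ψ, ⟨-, hψ⟩, rfl⟩) v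
  · rw [eval_atom_crispInterp, if_pos hA]
  · rw [Formula.eval_neg, eval_atom_crispInterp, if_neg fun hA => hAB n hA hB, sub_self]
  · rcases eval_crispInterp_eq_zero_or_one A hψ v with h | h <;>
      simp [Formula.or, Formula.eval, Formula.eval_neg, h]

theorem Interp.diagram_code_iff {M : Type*} (S : Interp M) (L : Lang) (e : ℕ → M) (φ : Formula)
    (s : List ℕ) (p q : UnitRat) : S.Diagram L e (φ.code, s, p.code, q.code) ↔
      φ.InLang L ∧ WayBelow p q (φ.eval S fun x => e (s.getD x 0)) := by
  constructor
  · rintro ⟨ψ, p', q', hψ, hφψ, hp, hq, h⟩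
    obtain rfl := Formula.code_injective hφψ
    obtain rfl := UnitRat.code_injective hp
    obtain rfl := UnitRat.code_injective hq
    exact ⟨hψ, h⟩
  · rintro ⟨hφ, h⟩
    exact ⟨φ, p, q, hφ, rfl, rfl, rfl, h⟩

theorem Interp.IsDecidable.rePred_wayBelow {M : Type*} [MetricSpace M] {S : Interp M} {L : Lang}
    (hS : S.IsDecidable L) {α : Type*} [Primcodable α] {f : α → Formula} (hf : Primrec f)
    (inLang : ∀ a, (f a).InLang L) (isSentence : ∀ a, (f a).IsSentence) (v : ℕ → M)
    (p q : UnitRat) : REPred fun a => WayBelow p q ((f a).eval S v) := by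
  obtain ⟨-, -, -, e, -, hD⟩ := hS
  have primrec_code : Primrec fun a => ((f a).code, ([] : List ℕ), p.code, q.code) :=
    (Primrec.encode.comp hf).pair (Primrec.const _)
  refine (rePred_comp hD primrec_code.to_comp).of_eq fun a => ?_
  rw [S.diagram_code_iff, and_iff_right (inLang a), (isSentence a).eval_eq S _ v]

namespace separationTheory

variable {A B : ℕ → Prop}

/-- The truth degree of an atom can be recognized to be below `2 / 3` or to be above `1 / 3`. -/
theorem not_hasDecidableModel (hAB : RecursivelyInseparable A B) :
    ¬ Theory.HasDecidableModel.{u} (separationTheory A B) := by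
  rintro ⟨M, _, S, v, hS, hmodels⟩
  have rePred := hS.rePred_wayBelow primrec_atom atom_inLang atom_isSentence v
  have cover : ∀ n, WayBelow ⟨0, by norm_num⟩ ⟨2 / 3, by norm_num⟩ ((atom n).eval S v) ∨
      WayBelow ⟨1 / 3, by norm_num⟩ ⟨1, by norm_num⟩ ((atom n).eval S v) := fun n => by
    rcases lt_or_ge ((atom n).eval S v) (2 / 3) with h | h
    · exact .inl ⟨.inr rfl, .inl (by simpa using h)⟩
    · exact .inr ⟨.inl (by push_cast; linarith), .inr rfl⟩
  have : Nonempty M := ⟨v 0⟩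
  rcases hAB.exists_of_rePred_cover (rePred _ _) (rePred _ _) cover with
    ⟨n, hA, hlt, -⟩ | ⟨n, hB, -, hlt⟩
  · have h0 : (atom n).eval S v = 0 := hmodels _ (atom_mem_axioms hA)
    norm_num [h0] at hlt
  · have h1 : 1 - (atom n).eval S v = 0 :=
      (Formula.eval_neg S _ v).symm.trans (hmodels _ (neg_atom_mem_axioms hB))
    norm_num [← sub_eq_zero.1 h1] at hlt

/-- Which of `¬ a → a` and `a → ¬ a` is provable separates the provable from the refutable
atoms `a`. -/
theorem not_linearComplete_of_extends (hAB : RecursivelyInseparable A B) {T : Theory}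
    (hT : T.Extends (separationTheory A B)) (hax : T.ComputablyAxiomatizable)
    (hcon : T.Consistent) : ¬ T.LinearComplete := by
  intro hlin
  obtain ⟨hfuns, hrels, hproves⟩ := hT
  have inLang : ∀ n, (atom n).InLang T.lang := fun n =>
    ⟨hrels rfl, fun _ => ⟨hfuns rfl, fun j => j.elim0⟩⟩
  have neg_isSentence : ∀ n, (atom n).neg.IsSentence := fun n x h =>
    h.elim (atom_isSentence n x) id
  have rePred {f : ℕ → Formula} (hf : Primrec f) : REPred fun n => T.Proves (f n) :=
    rePred_comp hax.rePred_proves hf.to_comp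
  have primrec_atom := primrec_atom
  have primrec_neg : Primrec fun n => (atom n).neg := by
    unfold Formula.neg
    fun_prop
  have cover : ∀ n, T.Proves (.imp (atom n).neg (atom n)) ∨ T.Proves (.imp (atom n) (atom n).neg) :=
    fun n => hlin _ _ ⟨inLang n, trivial⟩ (inLang n) (neg_isSentence n) (atom_isSentence n)
  rcases hAB.exists_of_rePred_cover (rePred (by fun_prop)) (rePred (by fun_prop)) cover with
    ⟨n, hA, himp⟩ | ⟨n, hB, himp⟩
  · have holds := hproves _ (atom_mem_axioms hA)
    exact hcon (.mp holds (.mp holds himp))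
  · have fails := hproves _ (neg_atom_mem_axioms hB)
    exact hcon (.mp (.mp fails himp) fails)

end separationTheory

end RPL

theorem corollary3p11 :
    ∃ T : RPL.Theory,
      (T.ComputablyAxiomatizable ∧ T.Consistent ∧ T.IsLukasiewicz ∧ T.Classical ∧
        ¬ RPL.Theory.HasDecidableModel.{u} T) ∧
      ¬ ∃ T' : RPL.Theory,
        T'.Extends T ∧ T'.ComputablyAxiomatizable ∧ T'.Consistent ∧ T'.LinearComplete :=
  have inseparable := RPL.recursivelyInseparable_selfOutput 0 1
  ⟨RPL.separationTheory (RPL.SelfOutput 0) (RPL.SelfOutput 1),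
    ⟨RPL.separationTheory.computablyAxiomatizable (RPL.rePred_selfOutput 0)
        (RPL.rePred_selfOutput 1),
      RPL.separationTheory.consistent fun _ => RPL.not_selfOutput zero_ne_one,
      RPL.separationTheory.isLukasiewicz, RPL.separationTheory.classical,
      RPL.separationTheory.not_hasDecidableModel inseparable⟩,
    fun ⟨_, extends_T, axiomatizable, consistent, linearComplete⟩ =>
      RPL.separationTheory.not_linearComplete_of_extends inseparable extends_T axiomatizable
        consistent linearComplete⟩
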